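/- \textbf{Setting.} Let $\varphi:\mathbb R_+\to[0,\infty]$ be convex and lower semicontinuous with $\varphi^{-1}(\{0\})=\{1\}$; put $\varphi'_\infty=\lim_{r\to\infty}\varphi(r)/r$, $\psi(r)=r\,\varphi(1/r)$ for $r>0$ and $\psi(0)=\varphi'_\infty$. Let $\lambda:\mathbb R_+\to[0,\infty]$ satisfy $\lambda^{-1}(\{0\})=\{0\}$, let $\Delta$ be a distance on the set $\mathbb R_+$ such that $(t,u)\mapsto\lambda(\Delta(t,u))$ is lower semicontinuous for the usual topology (for instance, $\lambda$ lower semicontinuous and $\Delta(t,u)=|t-u|$), and let $p>0$, $q>0$. For $c\in[0,\infty]$ and $r,s\ge 0$ let $$H_c(r,s)=\inf_{\theta\ge 0}\ \theta\big(c+\psi(\tfrac r\theta)+\psi(\tfrac s\theta)\big),$$ where the expression is read as $\varphi(0)(r+s)$ at $\theta=0$. For a nonempty set $X$ let $\mathfrak C[X]=(X\times\mathbb R_+)/(X\times\{0\})$ be the cone over $X$, with points $[x,r]$. The cone cost $\mathfrak D$ on $\mathfrak C[\mathbb R_+]$ is defined by $$\mathfrak D([t,r],[u,s])^q=H_{\lambda(\Delta(t,u))}(r^p,s^p),$$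 where, if the right-hand side depends on the choice of representatives (which can happen only if $r=0$ or $s=0$), the infimum over representatives is taken. An mm-space $\mathcal X=(X,d_X,\mu)$ is a nonempty complete separable metric space with a finite positive Borel measure. Two mm-spaces $(X,d_X,\mu)$, $(Y,d_Y,\nu)$ are \emph{isometric} if there is a distance-preserving bijection of $\operatorname{supp}\mu$ onto $\operatorname{supp}\nu$ that pushes $\mu$ forward to $\nu$. Let $\mathcal U_p(\mu,\nu)$ be the set of finite positive measures $\alpha$ on $\mathfrak C[X]\times\mathfrak C[Y]$, with marginals $\alpha_1,\alpha_2$, such that $\int_{\mathbb R_+} r^p\,d\alpha_1(\cdot,r)=\mu$ and $\int_{\mathbb R_+} s^p\,d\alpha_2(\cdot,s)=\nu$, and let $$\mathrm{CGW}(\mathcal X,\mathcal Y)=\inf_{\alpha\in\mathcal U_p(\mu,\nu)}\iint \mathfrak D\big([d_X(x,x'),rr'],[d_Y(y,y'),ss']\big)^q\,d\alpha([x,r],[y,s])\,d\alpha([x',r'],[y',s'])\ \in[0,\infty].$$ \textbf{Theorem.} $\mathrm{CGW}$ is nonnegative and symmetric, and $\mathrm{CGW}(\mathcal X,\mathcal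 Y)=0$ if and only if $\mathcal X$ and $\mathcal Y$ are isometric. If moreover $q\ge 1$ and $\mathfrak D$ is a (finite) distance on $\mathfrak C[\mathbb R_+]$, then $\mathrm{CGW}$ is finite and $\mathrm{CGW}^{1/q}$ is a distance on the set of mm-spaces up to isometry: it induces a metric on the set of isometry classes. -/

import Mathlib

open MeasureTheory Filter Set
open scoped NNReal ENNReal Topology

universe u

noncomputable section

namespace ConicGW

/-! ### Entropies and the perspective function -/

/-- Entropy functions `φ : ℝ₊ → [0, ∞]`: convex, lower semicontinuous, with `φ⁻¹({0}) = {1}`. -/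
structure IsEntropy (φ : ℝ≥0 → ℝ≥0∞) : Prop where
  convex : ConvexOn ℝ≥0 univ φ
  lsc : LowerSemicontinuous φ
  eq_zero_iff : ∀ x, φ x = 0 ↔ x = 1

/-- The recession constant `φ'_∞ = lim_{r → ∞} φ(r) / r` (the limit exists for an entropy). -/
def recession (φ : ℝ≥0 → ℝ≥0∞) : ℝ≥0∞ :=
  limsup (fun r : ℝ≥0 => φ r / (r : ℝ≥0∞)) atTop

/-- The reverse entropy `ψ(r) = r φ(1 / r)`, `ψ(0) = φ'_∞`. -/
def reverseEntropy (φ : ℝ≥0 → ℝ≥0∞) (r : ℝ≥0) : ℝ≥0∞ :=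
  if r = 0 then recession φ else (r : ℝ≥0∞) * φ (1 / r)

/-- The expression `θ (c + ψ(r / θ) + ψ(s / θ))`. At `θ = 0` it is read as
`ψ'_∞ (r + s) = φ(0) (r + s)`, for every `c ∈ [0, ∞]`. -/
def perspective (φ : ℝ≥0 → ℝ≥0∞) (c : ℝ≥0∞) (r s θ : ℝ≥0) : ℝ≥0∞ :=
  if θ = 0 then φ 0 * ((r : ℝ≥0∞) + s)
  else (θ : ℝ≥0∞) * (c + reverseEntropy φ (r / θ) + reverseEntropy φ (s / θ))

/-- `H_c(r, s) = inf_{θ ≥ 0} θ (c + ψ(r / θ) + ψ(s / θ))`. -/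
def homogCost (φ : ℝ≥0 → ℝ≥0∞) (c : ℝ≥0∞) (r s : ℝ≥0) : ℝ≥0∞ :=
  ⨅ θ : ℝ≥0, perspective φ c r s θ

/-! ### The cone over a set -/

/-- The relation on `X × ℝ₊` that collapses `X × {0}` to a point. -/
def coneSetoid (X : Type*) : Setoid (X × ℝ≥0) where
  r a b := a = b ∨ (a.2 = 0 ∧ b.2 = 0)
  iseqv :=
    { refl := fun _ => Or.inl rfl
      symm := by
        rintro a b (h | ⟨h, h'⟩)
        · exact Or.inl h.symm
        · exact Or.inr ⟨h', h⟩
      trans := by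
        rintro a b c (rfl | ⟨h, h'⟩) (rfl | ⟨k, k'⟩)
        · exact Or.inl rfl
        · exact Or.inr ⟨k, k'⟩
        · exact Or.inr ⟨h, h'⟩
        · exact Or.inr ⟨h, k'⟩ }

/-- The cone `Co[X] = (X × ℝ₊) / (X × {0})`. -/
def Cone (X : Type*) : Type _ := Quotient (coneSetoid X)

/-- The class `[x, r]`. -/
def Cone.mk {X : Type*} (x : X) (r : ℝ≥0) : Cone X := Quotient.mk (coneSetoid X) (x, r)

/-- The radial coordinate `[x, r] ↦ r`. -/
def Cone.radius {X : Type*} : Cone X → ℝ≥0 :=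
  Quotient.lift (fun a : X × ℝ≥0 => a.2) (by
    rintro a b (rfl | ⟨h, h'⟩)
    · rfl
    · exact h.trans h'.symm)

/-- The quotient `σ`-algebra. Over a separable metric space with its Borel sets, it is the Borel
`σ`-algebra of the cone: the apex is a measurable point, and off the apex one has the Borel sets
of `X × (0, ∞)`. -/
instance Cone.instMeasurableSpace (X : Type*) [MeasurableSpace X] : MeasurableSpace (Cone X) :=
  inferInstanceAs (MeasurableSpace (Quotient (coneSetoid X)))

/-- The map `([x, r], [x', r']) ↦ [d(x, x'), r r']` from `Co[X] × Co[X]` to `Co[ℝ₊]`. -/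
def Cone.pair {X : Type*} [MetricSpace X] : Cone X → Cone X → Cone ℝ≥0 :=
  Quotient.lift₂ (fun a b : X × ℝ≥0 => Cone.mk (nndist a.1 b.1) (a.2 * b.2)) (by
    rintro a b a' b' (rfl | ⟨h, h'⟩) (rfl | ⟨k, k'⟩)
    · rfl
    all_goals exact Quotient.sound (Or.inr (by simp [*])))

/-! ### The cone cost on `Co[ℝ₊]` -/

/-- `D` is a distance on `T` (with values in `[0, ∞)`). -/
structure IsDistance {T : Type*} (D : T → T → ℝ≥0∞) : Prop where
  ne_top : ∀ a b, D a b ≠ ∞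
  eq_zero_iff : ∀ a b, D a b = 0 ↔ a = b
  symm : ∀ a b, D a b = D b a
  triangle : ∀ a b c, D a c ≤ D a b + D b c

/-- The cone cost `𝔇` on `Co[ℝ₊]`, given by `𝔇([t, r], [u, s])^q = H_{λ(Δ(t, u))}(r^p, s^p)`.
For some entropies the right-hand side at the apex depends on the representative `(t, 0)`; the
infimum over representatives is taken. It has no effect if `r, s > 0`
(`coneDist_mk_rpow_of_pos`), and none at all if the formula is compatible with the quotient
(`coneDist_mk_rpow`). -/
def coneDist (φ lam : ℝ≥0 → ℝ≥0∞) (Δ : ℝ≥0 → ℝ≥0 → ℝ≥0) (p q : ℝ) (a b : Cone ℝ≥0) : ℝ≥0∞ :=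
  (⨅ (t : ℝ≥0) (r : ℝ≥0) (_ : Cone.mk t r = a) (u : ℝ≥0) (s : ℝ≥0) (_ : Cone.mk u s = b),
    homogCost φ (lam (Δ t u)) (r ^ p) (s ^ p)) ^ (1 / q)

theorem Cone.mk_eq_mk {X : Type*} {x y : X} {r s : ℝ≥0} :
    Cone.mk x r = Cone.mk y s ↔ (x = y ∧ r = s) ∨ (r = 0 ∧ s = 0) := by
  constructor
  · intro h
    rcases Quotient.exact h with h | h
    · exact Or.inl (by simpa using h)
    · exact Or.inr h
  · rintro (⟨rfl, rfl⟩ | h)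
    · rfl
    · exact Quotient.sound (Or.inr h)

theorem coneDist_mk_rpow (φ lam : ℝ≥0 → ℝ≥0∞) (Δ : ℝ≥0 → ℝ≥0 → ℝ≥0) (p q : ℝ) (hq : 0 < q)
    (h : ∀ t t' r u u' s : ℝ≥0, (t = t' ∨ r = 0) → (u = u' ∨ s = 0) →
      homogCost φ (lam (Δ t u)) (r ^ p) (s ^ p) = homogCost φ (lam (Δ t' u')) (r ^ p) (s ^ p))
    (t r u s : ℝ≥0) :
    coneDist φ lam Δ p q (Cone.mk t r) (Cone.mk u s) ^ q =
      homogCost φ (lam (Δ t u)) (r ^ p) (s ^ p) := by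
  unfold coneDist
  rw [← ENNReal.rpow_mul, one_div, inv_mul_cancel₀ hq.ne', ENNReal.rpow_one]
  refine le_antisymm ?_ ?_
  · exact iInf_le_of_le t <| iInf_le_of_le r <| iInf_le_of_le rfl <| iInf_le_of_le u <|
      iInf_le_of_le s <| iInf_le_of_le rfl le_rfl
  · refine le_iInf fun t' => le_iInf fun r' => le_iInf fun h1 => le_iInf fun u' =>
      le_iInf fun s' => le_iInf fun h2 => ?_
    rw [Cone.mk_eq_mk] at h1 h2
    have e1 : r' = r := by rcases h1 with h1 | h1 <;> simp [h1]
    have e2 : s' = s := by rcases h2 with h2 | h2 <;> simp [h2]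
    subst e1 e2
    exact (h t t' r' u u' s' (by tauto) (by tauto)).le

theorem coneDist_mk_rpow_of_pos (φ lam : ℝ≥0 → ℝ≥0∞) (Δ : ℝ≥0 → ℝ≥0 → ℝ≥0) (p q : ℝ)
    (hq : 0 < q) (t r u s : ℝ≥0) (hr : 0 < r) (hs : 0 < s) :
    coneDist φ lam Δ p q (Cone.mk t r) (Cone.mk u s) ^ q =
      homogCost φ (lam (Δ t u)) (r ^ p) (s ^ p) := by
  unfold coneDist
  rw [← ENNReal.rpow_mul, one_div, inv_mul_cancel₀ hq.ne', ENNReal.rpow_one]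
  refine le_antisymm ?_ ?_
  · exact iInf_le_of_le t <| iInf_le_of_le r <| iInf_le_of_le rfl <| iInf_le_of_le u <|
      iInf_le_of_le s <| iInf_le_of_le rfl le_rfl
  · refine le_iInf fun t' => le_iInf fun r' => le_iInf fun h1 => le_iInf fun u' =>
      le_iInf fun s' => le_iInf fun h2 => ?_
    rw [Cone.mk_eq_mk] at h1 h2
    obtain ⟨rfl, rfl⟩ : t' = t ∧ r' = r := h1.resolve_right fun k => hr.ne' k.2
    obtain ⟨rfl, rfl⟩ : u' = u ∧ s' = s := h2.resolve_right fun k => hs.ne' k.2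
    exact le_rfl

/-! ### Metric measure spaces -/

/-- A metric measure space: a nonempty complete separable metric space with a finite positive
Borel measure. -/
structure MMSpace : Type (u + 1) where
  carrier : Type u
  [metric : MetricSpace carrier]
  [complete : CompleteSpace carrier]
  [separable : TopologicalSpace.SeparableSpace carrier]
  [nonempty : Nonempty carrier]
  [measurable : MeasurableSpace carrier]
  [borel : BorelSpace carrier]
  meas : Measure carrier
  [finite : IsFiniteMeasure meas]

attribute [instance] MMSpace.metric MMSpace.complete MMSpace.separable MMSpace.nonempty
  MMSpace.measurable MMSpace.borel MMSpace.finite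

/-- `𝒳 ∼ 𝒴`: there is an isometric bijection between the supports of the measures that carries
the one measure to the other. -/
def MMSpace.Isometric (X Y : MMSpace) : Prop :=
  ∃ ψ : X.meas.support ≃ᵢ Y.meas.support,
    (X.meas.comap (Subtype.val : X.meas.support → X.carrier)).map ψ =
      Y.meas.comap (Subtype.val : Y.meas.support → Y.carrier)

theorem MMSpace.isometric_equivalence : Equivalence MMSpace.Isometric.{u} where
  refl X := ⟨IsometryEquiv.refl _, Measure.map_id⟩
  symm := by
    rintro X Y ⟨ψ, h⟩
    refine ⟨ψ.symm, ?_⟩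
    rw [← h, Measure.map_map ψ.symm.continuous.measurable ψ.continuous.measurable]
    have : (ψ.symm : Y.meas.support → X.meas.support) ∘ ψ = id := by
      funext x
      exact ψ.symm_apply_apply x
    rw [this, Measure.map_id]
  trans := by
    rintro X Y Z ⟨ψ, h⟩ ⟨χ, k⟩
    refine ⟨ψ.trans χ, ?_⟩
    rw [← k, ← h, Measure.map_map χ.continuous.measurable ψ.continuous.measurable]
    rfl

/-- The equivalence relation "isometric" on mm-spaces. -/
def MMSpace.isometricSetoid : Setoid MMSpace.{u} :=
  ⟨MMSpace.Isometric, MMSpace.isometric_equivalence⟩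

/-! ### The conic Gromov-Wasserstein divergence -/

/-- The constraint `∫_{ℝ₊} r^p dβ(·, r) = μ` on a measure `β` on `Co[X]`. The apex belongs to the
image below when `A` is nonempty, but has weight `0^p = 0`. -/
def HasConicMarginal {X : Type*} [MeasurableSpace X] (p : ℝ) (β : Measure (Cone X))
    (μ : Measure X) : Prop :=
  ∀ A : Set X, MeasurableSet A →
    ∫⁻ c in (fun a : X × ℝ≥0 => Cone.mk a.1 a.2) '' (A ×ˢ univ), ((c.radius ^ p : ℝ≥0) : ℝ≥0∞) ∂β
      = μ A

/-- The set `𝒰_p(μ, ν)` of finite positive measures on `Co[X] × Co[Y]` with conic marginals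
`μ` and `ν`. -/
def conicPlans (p : ℝ) (X Y : MMSpace.{u}) : Set (Measure (Cone X.carrier × Cone Y.carrier)) :=
  {α | IsFiniteMeasure α ∧ HasConicMarginal p α.fst X.meas ∧ HasConicMarginal p α.snd Y.meas}

/-- `ℋ(α) = ∫∫ 𝔇([d_X(x, x'), r r'], [d_Y(y, y'), s s'])^q dα([x, r], [y, s]) dα([x', r'], [y', s'])`. -/
def conicFunctional (φ lam : ℝ≥0 → ℝ≥0∞) (Δ : ℝ≥0 → ℝ≥0 → ℝ≥0) (p q : ℝ) {X Y : MMSpace.{u}}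
    (α : Measure (Cone X.carrier × Cone Y.carrier)) : ℝ≥0∞ :=
  ∫⁻ w, ∫⁻ z, coneDist φ lam Δ p q (Cone.pair w.1 z.1) (Cone.pair w.2 z.2) ^ q ∂α ∂α

/-- `CGW(𝒳, 𝒴) = inf_{α ∈ 𝒰_p(μ, ν)} ℋ(α)`. -/
def CGW (φ lam : ℝ≥0 → ℝ≥0∞) (Δ : ℝ≥0 → ℝ≥0 → ℝ≥0) (p q : ℝ) (X Y : MMSpace.{u}) : ℝ≥0∞ :=
  ⨅ α ∈ conicPlans p X Y, conicFunctional φ lam Δ p q α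

end ConicGW

end

noncomputable section

namespace ConicGW

/-!
In the coordinates `(x, a)` with `a = r ^ p` the exponent disappears: the pair cost of a plan on
weighted points is jointly `1`-homogeneous in the weights, so the plan may be multiplied by a
density `f` while both weights are divided by `f`, changing neither the marginals nor the energy.

If the infimum vanishes, normalise a minimising sequence by `a + b = 1`. The energy tends to `0`
and the cone cost separates points, so the two weights agree in the limit and the measures
`min a b · β` converge weakly to a coupling of `μ` and `ν`. By lower semicontinuity the cost
vanishes on its support, that is, the coupling is carried by pairs with equal distances, and its
support is the graph of an isometry.

For the triangle inequality, rescale so that the middle weight is `1`, except for mass at the apex,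
which can be added freely to make the two middle marginals equal. The plans can then be glued,
and Minkowski's inequality in `L^q` concludes.
-/

/-! ### Entropies and their perspective -/

section Entropy

variable {φ : ℝ≥0 → ℝ≥0∞}

theorem IsEntropy.apply_one (hφ : IsEntropy φ) : φ 1 = 0 :=
  (hφ.eq_zero_iff 1).2 rfl

theorem IsEntropy.mul_le_mul (hφ : IsEntropy φ) {x y : ℝ≥0} (hx : 1 ≤ x) (hxy : x ≤ y) :
    φ x * y ≤ x * φ y := by
  rcases (hx.trans hxy).eq_or_lt with rfl | hy
  · obtain rfl := le_antisymm hxy hx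
    simp [hφ.apply_one]
  obtain ⟨x, rfl⟩ := exists_add_of_le hx
  obtain ⟨y, rfl⟩ := exists_add_of_le hy.le
  have hxy : x ≤ y := le_of_add_le_add_left hxy
  have hy : y ≠ 0 := by rintro rfl; simp at hy
  set t : ℝ≥0 := x / y
  have ht : t ≤ 1 := div_le_one_of_le₀ hxy zero_le
  have hty : t * y = x := div_mul_cancel₀ _ hy
  have hcomb : (1 - t) • (1 : ℝ≥0) + t • (1 + y) = 1 + x := by
    rw [smul_eq_mul, smul_eq_mul, mul_one, mul_add, mul_one, hty, ← add_assoc,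
      tsub_add_cancel_of_le ht]
  have hconv : φ (1 + x) ≤ t * φ (1 + y) := by
    have h := hφ.convex.2 (mem_univ 1) (mem_univ (1 + y)) (zero_le (a := 1 - t))
      (zero_le (a := t)) (tsub_add_cancel_of_le ht)
    rwa [hcomb, hφ.apply_one, smul_zero, zero_add] at h
  have hle : t * (1 + y) ≤ 1 + x := by
    rw [mul_add, mul_one, hty]
    gcongr
  calc φ (1 + x) * (1 + y : ℝ≥0) ≤ t * φ (1 + y) * (1 + y : ℝ≥0) := by gcongr
    _ = ((t * (1 + y) : ℝ≥0) : ℝ≥0∞) * φ (1 + y) := by rw [ENNReal.coe_mul]; ring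
    _ ≤ (1 + x : ℝ≥0) * φ (1 + y) := by gcongr

theorem IsEntropy.div_le_div (hφ : IsEntropy φ) {x y : ℝ≥0} (hx : 1 ≤ x) (hxy : x ≤ y) :
    φ x / x ≤ φ y / y := by
  have hx0 : (x : ℝ≥0∞) ≠ 0 := by simpa using (zero_lt_one.trans_le hx).ne'
  have hy0 : (y : ℝ≥0∞) ≠ 0 := by simpa using (zero_lt_one.trans_le (hx.trans hxy)).ne'
  rw [ENNReal.div_le_iff hx0 ENNReal.coe_ne_top, ENNReal.div_eq_inv_mul, mul_assoc,
    mul_comm (φ y), ← ENNReal.div_eq_inv_mul, ENNReal.le_div_iff_mul_le (Or.inl hy0) (by simp)]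
  exact hφ.mul_le_mul hx hxy

theorem IsEntropy.le_mul_recession (hφ : IsEntropy φ) {x : ℝ≥0} (hx : 1 ≤ x) :
    φ x ≤ x * recession φ := by
  have hx0 : (x : ℝ≥0∞) ≠ 0 := by simpa using (zero_lt_one.trans_le hx).ne'
  have hslope : φ x / x ≤ recession φ :=
    le_limsup_of_frequently_le
      ((eventually_ge_atTop x).mono fun y hy => hφ.div_le_div hx hy).frequently
  rw [mul_comm]
  exact (ENNReal.div_le_iff hx0 ENNReal.coe_ne_top).1 hslope

theorem IsEntropy.recession_ne_zero (hφ : IsEntropy φ) : recession φ ≠ 0 := by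
  intro h
  have htwo : φ 2 ≤ 0 := by simpa [h] using hφ.le_mul_recession (x := 2) one_le_two
  rw [nonpos_iff_eq_zero, hφ.eq_zero_iff] at htwo
  norm_num at htwo

theorem exists_mul_le_of_lt_recession {C : ℝ≥0∞} (hC : C < recession φ) :
    ∃ x : ℝ≥0, 1 ≤ x ∧ C * x ≤ φ x := by
  obtain ⟨x, hCx, hx⟩ := ((frequently_lt_of_lt_limsup (by isBoundedDefault) hC).and_eventually
    (eventually_ge_atTop (1 : ℝ≥0))).exists
  have hx0 : (x : ℝ≥0∞) ≠ 0 := by simpa using (zero_lt_one.trans_le hx).ne'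
  exact ⟨x, hx, (ENNReal.le_div_iff_mul_le (Or.inl hx0) (by simp)).1 hCx.le⟩

/-- The perspective `(θ, r) ↦ r φ(θ / r)` of an entropy, extended by `θ φ'_∞` to `r = 0`. The
expression minimised in `H_c(r, s)` is `θ c` plus the perspectives at `(θ, r)` and `(θ, s)`. -/
def entropyPerspective (φ : ℝ≥0 → ℝ≥0∞) (θ r : ℝ≥0) : ℝ≥0∞ :=
  if r = 0 then θ * recession φ else r * φ (θ / r)

theorem perspective_eq (φ : ℝ≥0 → ℝ≥0∞) (c : ℝ≥0∞) (r s θ : ℝ≥0) :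
    perspective φ c r s θ = θ * c + entropyPerspective φ θ r + entropyPerspective φ θ s := by
  have hzero : ∀ r, entropyPerspective φ 0 r = φ 0 * r := fun r => by
    by_cases hr : r = 0 <;> simp [entropyPerspective, hr, mul_comm]
  have hreverse : ∀ r, θ ≠ 0 →
      (θ : ℝ≥0∞) * reverseEntropy φ (r / θ) = entropyPerspective φ θ r := by
    intro r hθ
    by_cases hr : r = 0
    · simp [entropyPerspective, reverseEntropy, hr]
    · have hcancel : θ * (r / θ) = r := mul_div_cancel₀ _ hθ
      rw [entropyPerspective, reverseEntropy, if_neg hr, if_neg (div_ne_zero hr hθ), ← mul_assoc,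
        ← ENNReal.coe_mul, hcancel, one_div_div]
  by_cases hθ : θ = 0
  · subst hθ
    simp [perspective, hzero, mul_add]
  · rw [perspective, if_neg hθ, mul_add, mul_add, hreverse r hθ, hreverse s hθ]

theorem IsEntropy.entropyPerspective_eq_zero_iff (hφ : IsEntropy φ) {θ r : ℝ≥0} :
    entropyPerspective φ θ r = 0 ↔ θ = r := by
  by_cases hr : r = 0
  · simp [entropyPerspective, hr, hφ.recession_ne_zero]
  · simp [entropyPerspective, hr, hφ.eq_zero_iff, div_eq_one_iff_eq hr]

theorem entropyPerspective_mul (φ : ℝ≥0 → ℝ≥0∞) {k : ℝ≥0} (hk : k ≠ 0) (θ r : ℝ≥0) :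
    entropyPerspective φ (k * θ) (k * r) = k * entropyPerspective φ θ r := by
  by_cases hr : r = 0
  · simp [entropyPerspective, hr, mul_assoc]
  · rw [entropyPerspective, entropyPerspective, if_neg hr, if_neg (mul_ne_zero hk hr),
      mul_div_mul_left _ _ hk, ENNReal.coe_mul, mul_assoc]

theorem IsEntropy.mul_le_entropyPerspective (hφ : IsEntropy φ) {C : ℝ≥0∞} {x θ r : ℝ≥0}
    (hx : 1 ≤ x) (hC : C * x ≤ φ x) (hθ : x * r ≤ θ) : C * θ ≤ entropyPerspective φ θ r := by
  have hx0 : (x : ℝ≥0∞) ≠ 0 := by simpa using (zero_lt_one.trans_le hx).ne'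
  rw [← ENNReal.mul_le_mul_iff_right hx0 ENNReal.coe_ne_top]
  by_cases hr : r = 0
  · calc (x : ℝ≥0∞) * (C * θ) = C * x * θ := by ring
      _ ≤ x * recession φ * θ := by gcongr ?_ * _; exact hC.trans (hφ.le_mul_recession hx)
      _ = x * entropyPerspective φ θ r := by simp [entropyPerspective, hr]; ring
  · have hxr : x ≤ θ / r := (le_div_iff₀ (pos_of_ne_zero hr)).2 hθ
    have hθr : (θ : ℝ≥0∞) = r * (θ / r : ℝ≥0) := by
      rw [← ENNReal.coe_mul, mul_div_cancel₀ _ hr]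
    calc (x : ℝ≥0∞) * (C * θ) = r * (C * x * (θ / r : ℝ≥0)) := by rw [hθr]; ring
      _ ≤ r * (x * φ (θ / r)) := by
        gcongr _ * ?_
        exact (mul_le_mul_left hC _).trans (hφ.mul_le_mul hx hxr)
      _ = x * entropyPerspective φ θ r := by rw [entropyPerspective, if_neg hr]; ring

theorem IsEntropy.entropyPerspective_mono (hφ : IsEntropy φ) {θ θ' r : ℝ≥0} (hr : r ≤ θ)
    (hθ : θ ≤ θ') : entropyPerspective φ θ r ≤ entropyPerspective φ θ' r := by
  by_cases h0 : r = 0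
  · simp only [entropyPerspective, h0, if_true]
    gcongr
  have hone : 1 ≤ θ / r := (one_le_div (pos_of_ne_zero h0)).2 hr
  have hle : θ / r ≤ θ' / r := by gcongr
  have hpos : ((θ / r : ℝ≥0) : ℝ≥0∞) ≠ 0 := by simpa using (zero_lt_one.trans_le hone).ne'
  have hφle : φ (θ / r) ≤ φ (θ' / r) := by
    rw [← ENNReal.mul_le_mul_iff_right hpos ENNReal.coe_ne_top, mul_comm]
    exact le_trans (by gcongr) (hφ.mul_le_mul hone hle)
  simp only [entropyPerspective, if_neg h0]
  gcongr

theorem exists_lt_lt_of_lt_mul {a b y : ℝ≥0∞} (h : y < a * b) :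
    ∃ a' < a, ∃ b' < b, y < a' * b' := by
  by_contra! H
  exact absurd (ENNReal.mul_le_of_forall_lt fun a' ha b' hb => H a' ha b' hb) (not_le.2 h)

theorem lowerSemicontinuousAt_mul {T : Type*} [TopologicalSpace T] {f g : T → ℝ≥0∞} {x : T}
    (hf : LowerSemicontinuousAt f x) (hg : LowerSemicontinuousAt g x) :
    LowerSemicontinuousAt (fun z => f z * g z) x := by
  intro y hy
  obtain ⟨a, ha, b, hb, hab⟩ := exists_lt_lt_of_lt_mul hy
  filter_upwards [hf a ha, hg b hb] with z hz1 hz2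
  exact hab.trans_le (mul_le_mul' hz1.le hz2.le)

theorem IsEntropy.lowerSemicontinuousAt_entropyPerspective_zero (hφ : IsEntropy φ) (θ : ℝ≥0) :
    LowerSemicontinuousAt (fun z : ℝ≥0 × ℝ≥0 => entropyPerspective φ z.1 z.2) (θ, 0) := by
  intro y hy
  simp only [entropyPerspective, if_true] at hy
  obtain ⟨a, ha, C, hC, haC⟩ := exists_lt_lt_of_lt_mul hy
  obtain ⟨x, hx, hCx⟩ := exists_mul_le_of_lt_recession hC
  lift a to ℝ≥0 using ha.ne_top
  have ha : a < θ := by simpa using ha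
  have hlt : ∀ᶠ z : ℝ≥0 × ℝ≥0 in 𝓝 (θ, 0), x * z.2 < z.1 := by
    have hcont : ContinuousAt (fun z : ℝ≥0 × ℝ≥0 => x * z.2) (θ, 0) := by fun_prop
    exact hcont.eventually_lt continuous_fst.continuousAt (by simpa using zero_le.trans_lt ha)
  filter_upwards [hlt, continuous_fst.continuousAt.eventually_const_lt ha] with z hxz haz
  calc y < a * C := haC
    _ ≤ C * z.1 := by rw [mul_comm]; gcongr
    _ ≤ entropyPerspective φ z.1 z.2 := hφ.mul_le_entropyPerspective hx hCx hxz.le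

theorem IsEntropy.lowerSemicontinuousAt_entropyPerspective_of_ne_zero (hφ : IsEntropy φ) (θ : ℝ≥0)
    {r : ℝ≥0} (hr : r ≠ 0) :
    LowerSemicontinuousAt (fun z : ℝ≥0 × ℝ≥0 => entropyPerspective φ z.1 z.2) (θ, r) := by
  have hdiv : ContinuousAt (fun z : ℝ≥0 × ℝ≥0 => z.1 / z.2) (θ, r) :=
    continuousAt_fst.div₀ continuousAt_snd hr
  have hmul : LowerSemicontinuousAt (fun z : ℝ≥0 × ℝ≥0 => (z.2 : ℝ≥0∞) * φ (z.1 / z.2)) (θ, r) :=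
    lowerSemicontinuousAt_mul ((ENNReal.continuous_coe.comp continuous_snd).lowerSemicontinuous _)
      fun y hy => hdiv.eventually (hφ.lsc _ y hy)
  have hne : ∀ᶠ z : ℝ≥0 × ℝ≥0 in 𝓝 (θ, r), z.2 ≠ 0 := continuousAt_snd.eventually_ne hr
  intro y hy
  simp only [entropyPerspective, hr, if_false] at hy
  filter_upwards [hmul y hy, hne] with z hyz hz
  simpa only [entropyPerspective, hz, if_false] using hyz

theorem IsEntropy.lowerSemicontinuous_entropyPerspective (hφ : IsEntropy φ) :
    LowerSemicontinuous (fun z : ℝ≥0 × ℝ≥0 => entropyPerspective φ z.1 z.2) := by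
  rintro ⟨θ, r⟩
  rcases eq_or_ne r 0 with rfl | hr
  · exact hφ.lowerSemicontinuousAt_entropyPerspective_zero θ
  · exact hφ.lowerSemicontinuousAt_entropyPerspective_of_ne_zero θ hr

end Entropy

/-! ### The homogeneous cost -/

section HomogeneousCost

variable {φ : ℝ≥0 → ℝ≥0∞}

theorem homogCost_eq (φ : ℝ≥0 → ℝ≥0∞) (c : ℝ≥0∞) (r s : ℝ≥0) :
    homogCost φ c r s =
      ⨅ θ : ℝ≥0, (θ * c + entropyPerspective φ θ r + entropyPerspective φ θ s) := by
  simp only [homogCost, perspective_eq]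

theorem homogCost_mono (φ : ℝ≥0 → ℝ≥0∞) {c c' : ℝ≥0∞} (h : c ≤ c') (r s : ℝ≥0) :
    homogCost φ c r s ≤ homogCost φ c' r s := by
  simp only [homogCost_eq]
  gcongr

theorem homogCost_comm (φ : ℝ≥0 → ℝ≥0∞) (c : ℝ≥0∞) (r s : ℝ≥0) :
    homogCost φ c r s = homogCost φ c s r := by
  simp only [homogCost_eq, add_assoc, add_comm (entropyPerspective φ _ r)]

theorem homogCost_zero_zero (φ : ℝ≥0 → ℝ≥0∞) (c : ℝ≥0∞) : homogCost φ c 0 0 = 0 := by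
  rw [homogCost_eq, ← nonpos_iff_eq_zero]
  exact (iInf_le _ 0).trans (by simp [entropyPerspective])

theorem homogCost_mul (φ : ℝ≥0 → ℝ≥0∞) (c : ℝ≥0∞) (k r s : ℝ≥0) :
    homogCost φ c (k * r) (k * s) = k * homogCost φ c r s := by
  by_cases hk : k = 0
  · simp [hk, homogCost_zero_zero]
  have hk' : (k : ℝ≥0∞) ≠ 0 := by simpa using hk
  rw [homogCost_eq, homogCost_eq, ENNReal.mul_iInf_of_ne hk' ENNReal.coe_ne_top]
  refine (Equiv.iInf_congr (Equiv.mulLeft₀ k hk) fun θ => ?_).symm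
  rw [Equiv.mulLeft₀_apply, entropyPerspective_mul φ hk, entropyPerspective_mul φ hk,
    ENNReal.coe_mul, mul_add, mul_add, mul_assoc]

theorem IsEntropy.homogCost_eq_biInf_Icc (hφ : IsEntropy φ) (c : ℝ≥0∞) (r s : ℝ≥0) :
    homogCost φ c r s = ⨅ η ∈ Icc (0 : ℝ≥0) 1, (((η * (r + s) : ℝ≥0) : ℝ≥0∞) * c +
      entropyPerspective φ (η * (r + s)) r + entropyPerspective φ (η * (r + s)) s) := by
  rw [homogCost_eq]
  refine le_antisymm (le_iInf₂ fun η _ => iInf_le _ _) (le_iInf fun θ => ?_)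
  rcases le_total θ (r + s) with h | h
  · by_cases h0 : r + s = 0
    · refine (iInf₂_le 0 (by simp)).trans (le_of_eq ?_)
      have hθ : θ = 0 := by simpa [h0] using h
      rw [zero_mul, hθ]
    · refine (iInf₂_le (θ / (r + s)) ⟨zero_le, div_le_one_of_le₀ h zero_le⟩).trans (le_of_eq ?_)
      rw [div_mul_cancel₀ _ h0]
  · refine (iInf₂_le 1 (by simp)).trans ?_
    rw [one_mul]
    gcongr
    · exact hφ.entropyPerspective_mono (by simp) h
    · exact hφ.entropyPerspective_mono (by simp) h

theorem IsEntropy.lowerSemicontinuous_mul_add_entropyPerspective (hφ : IsEntropy φ) {S : Type*}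
    [TopologicalSpace S] {c : S → ℝ≥0∞} {r s θ : S → ℝ≥0} (hc : LowerSemicontinuous c)
    (hr : Continuous r) (hs : Continuous s) (hθ : Continuous θ) :
    LowerSemicontinuous fun x => (θ x : ℝ≥0∞) * c x + entropyPerspective φ (θ x) (r x) +
      entropyPerspective φ (θ x) (s x) :=
  have hmul : LowerSemicontinuous fun x => (θ x : ℝ≥0∞) * c x := fun x =>
    lowerSemicontinuousAt_mul ((ENNReal.continuous_coe.comp hθ).lowerSemicontinuous x) (hc x)
  (hmul.add (hφ.lowerSemicontinuous_entropyPerspective.comp (hθ.prodMk hr))).add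
    (hφ.lowerSemicontinuous_entropyPerspective.comp (hθ.prodMk hs))

theorem IsEntropy.exists_homogCost_eq (hφ : IsEntropy φ) (c : ℝ≥0∞) (r s : ℝ≥0) :
    ∃ θ : ℝ≥0, homogCost φ c r s =
      θ * c + entropyPerspective φ θ r + entropyPerspective φ θ s := by
  obtain ⟨η, -, hmin⟩ := LowerSemicontinuousOn.exists_isMinOn ⟨0, by simp⟩
    (isCompact_Icc (a := (0 : ℝ≥0)) (b := 1))
    ((hφ.lowerSemicontinuous_mul_add_entropyPerspective (lowerSemicontinuous_const (z := c))
      (continuous_const (y := r)) (continuous_const (y := s))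
      (continuous_mul_const (r + s))).lowerSemicontinuousOn _)
  refine ⟨η * (r + s), le_antisymm ?_ ?_⟩
  · rw [homogCost_eq]
    exact iInf_le _ _
  · rw [hφ.homogCost_eq_biInf_Icc]
    exact le_iInf₂ fun η' hη' => hmin hη'

theorem IsEntropy.homogCost_eq_zero_iff (hφ : IsEntropy φ) {c : ℝ≥0∞} {r s : ℝ≥0} :
    homogCost φ c r s = 0 ↔ r = s ∧ (r = 0 ∨ c = 0) := by
  constructor
  · intro h
    obtain ⟨θ, hθ⟩ := hφ.exists_homogCost_eq c r s
    simp only [h, eq_comm (a := (0 : ℝ≥0∞)), add_eq_zero, hφ.entropyPerspective_eq_zero_iff,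
      mul_eq_zero, ENNReal.coe_eq_zero] at hθ
    obtain ⟨⟨hc, rfl⟩, rfl⟩ := hθ
    exact ⟨rfl, hc⟩
  · rintro ⟨rfl, h⟩
    rw [homogCost_eq, ← nonpos_iff_eq_zero]
    refine (iInf_le _ r).trans ?_
    rw [hφ.entropyPerspective_eq_zero_iff.2 rfl]
    simpa using h

theorem lowerSemicontinuous_iInf_of_isCompact {S T : Type*} [TopologicalSpace S]
    [TopologicalSpace T] {C : Set T} (hC : IsCompact C) {f : S → T → ℝ≥0∞}
    (hf : LowerSemicontinuous (fun z : S × T => f z.1 z.2)) :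
    LowerSemicontinuous (fun x => ⨅ η ∈ C, f x η) := by
  intro x y hy
  obtain ⟨y', hyy', hy'⟩ := exists_between hy
  have hopen : IsOpen {z : S × T | y' < f z.1 z.2} := hf.isOpen_preimage y'
  have hsub : ({x} : Set S) ×ˢ C ⊆ {z : S × T | y' < f z.1 z.2} := by
    rintro ⟨a, b⟩ ⟨ha, hb⟩
    obtain rfl : a = x := ha
    exact hy'.trans_le (iInf₂_le b hb)
  obtain ⟨U, V, hU, -, hxU, hCV, hUV⟩ := generalized_tube_lemma isCompact_singleton hC hopen hsub
  filter_upwards [hU.mem_nhds (hxU rfl)] with a ha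
  have hlt : ∀ η ∈ C, y' < f a η := fun η hη => hUV (mk_mem_prod ha (hCV hη))
  exact hyy'.trans_le (le_iInf₂ fun η hη => (hlt η hη).le)

theorem IsEntropy.lowerSemicontinuous_homogCost (hφ : IsEntropy φ) {S : Type*}
    [TopologicalSpace S] {c : S → ℝ≥0∞} {r s : S → ℝ≥0} (hc : LowerSemicontinuous c)
    (hr : Continuous r) (hs : Continuous s) :
    LowerSemicontinuous (fun x => homogCost φ (c x) (r x) (s x)) := by
  simp only [hφ.homogCost_eq_biInf_Icc]
  exact lowerSemicontinuous_iInf_of_isCompact isCompact_Icc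
    (hφ.lowerSemicontinuous_mul_add_entropyPerspective (hc.comp continuous_fst)
      (hr.comp continuous_fst) (hs.comp continuous_fst) (by fun_prop))

end HomogeneousCost

/-! ### Cone kernels -/

section ConeKernel

/-- The homogeneous cost between the points `(t, a)` and `(u, b)` of the cone over `ℝ₊` with base
cost `c`, where `a = r ^ p` and `b = s ^ p` in terms of the radii. Minimising over representatives
of the apex makes the base cost vanish there, which is encoded by the conditional. -/
def coneKernel (φ : ℝ≥0 → ℝ≥0∞) (c : ℝ≥0 → ℝ≥0 → ℝ≥0∞) (t u a b : ℝ≥0) : ℝ≥0∞ :=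
  homogCost φ (if a = 0 ∨ b = 0 then 0 else c t u) a b

/-- Costs on the cone over `ℝ₊`, in the coordinates `(t, a)` and `(u, b)` of two points, that are
lower semicontinuous, positively homogeneous, symmetric and definite. -/
structure IsConeKernel (K : ℝ≥0 → ℝ≥0 → ℝ≥0 → ℝ≥0 → ℝ≥0∞) : Prop where
  lsc : LowerSemicontinuous fun z : (ℝ≥0 × ℝ≥0) × (ℝ≥0 × ℝ≥0) => K z.1.1 z.1.2 z.2.1 z.2.2
  homog : ∀ k t u a b, K t u (k * a) (k * b) = k * K t u a b
  eq_zero_iff : ∀ t u a b, K t u a b = 0 ↔ a = b ∧ (a = 0 ∨ t = u)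
  apex : ∀ t u t' u' a b, a = 0 ∨ b = 0 → K t u a b = K t' u' a b
  symm : ∀ t u a b, K t u a b = K u t b a
  base_le : ∀ t u a b, K 0 0 a b ≤ K t u a b

theorem lowerSemicontinuous_ite_zero_or_zero {c : ℝ≥0 → ℝ≥0 → ℝ≥0∞}
    (hc : LowerSemicontinuous fun z : ℝ≥0 × ℝ≥0 => c z.1 z.2) :
    LowerSemicontinuous fun z : (ℝ≥0 × ℝ≥0) × (ℝ≥0 × ℝ≥0) =>
      if z.2.1 = 0 ∨ z.2.2 = 0 then 0 else c z.1.1 z.1.2 := by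
  intro z y hy
  by_cases hz : z.2.1 = 0 ∨ z.2.2 = 0
  · simp [hz] at hy
  simp only [hz, if_false] at hy
  push Not at hz
  have hfst : ∀ᶠ w : (ℝ≥0 × ℝ≥0) × (ℝ≥0 × ℝ≥0) in 𝓝 z, w.2.1 ≠ 0 :=
    (continuous_fst.comp continuous_snd).continuousAt.eventually_ne hz.1
  have hsnd : ∀ᶠ w : (ℝ≥0 × ℝ≥0) × (ℝ≥0 × ℝ≥0) in 𝓝 z, w.2.2 ≠ 0 :=
    (continuous_snd.comp continuous_snd).continuousAt.eventually_ne hz.2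
  filter_upwards [hc.comp continuous_fst z y hy, hfst, hsnd] with w hyw hw1 hw2
  simpa [hw1, hw2] using hyw

theorem isConeKernel_coneKernel {φ : ℝ≥0 → ℝ≥0∞} {c : ℝ≥0 → ℝ≥0 → ℝ≥0∞} (hφ : IsEntropy φ)
    (hc0 : ∀ t u, c t u = 0 ↔ t = u) (hcomm : ∀ t u, c t u = c u t)
    (hlsc : LowerSemicontinuous fun z : ℝ≥0 × ℝ≥0 => c z.1 z.2) :
    IsConeKernel (coneKernel φ c) where
  lsc := hφ.lowerSemicontinuous_homogCost (lowerSemicontinuous_ite_zero_or_zero hlsc)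
    (by fun_prop) (by fun_prop)
  homog k t u a b := by
    by_cases hk : k = 0
    · simp [coneKernel, hk, homogCost_zero_zero]
    · simp [coneKernel, hk, homogCost_mul]
  eq_zero_iff t u a b := by
    rw [coneKernel, hφ.homogCost_eq_zero_iff]
    refine and_congr_right fun hab => ?_
    subst hab
    by_cases ha : a = 0 <;> simp [ha, hc0]
  apex t u t' u' a b h := by simp [coneKernel, h]
  symm t u a b := by
    rw [coneKernel, coneKernel, homogCost_comm, hcomm]
    simp only [or_comm]
  base_le t u a b := homogCost_mono φ (by simp [(hc0 0 0).2 rfl]) a b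

theorem IsConeKernel.congr {K : ℝ≥0 → ℝ≥0 → ℝ≥0 → ℝ≥0 → ℝ≥0∞} (hK : IsConeKernel K)
    {t t' u u' a a' b b' : ℝ≥0} (h : Cone.mk t a = Cone.mk t' a')
    (h' : Cone.mk u b = Cone.mk u' b') : K t u a b = K t' u' a' b' := by
  rcases Cone.mk_eq_mk.1 h with ⟨rfl, rfl⟩ | ⟨rfl, rfl⟩
  · rcases Cone.mk_eq_mk.1 h' with ⟨rfl, rfl⟩ | ⟨rfl, rfl⟩
    · rfl
    · exact hK.apex _ _ _ _ _ _ (Or.inr rfl)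
  · rcases Cone.mk_eq_mk.1 h' with ⟨rfl, rfl⟩ | ⟨rfl, rfl⟩ <;>
      exact hK.apex _ _ _ _ _ _ (Or.inl rfl)

theorem coneDist_mk_rpow_of_eq_zero {φ lam : ℝ≥0 → ℝ≥0∞} {Δ : ℝ≥0 → ℝ≥0 → ℝ≥0} {p q : ℝ}
    (h0 : ∀ t, lam (Δ t t) = 0) (hq : 0 < q) (t u : ℝ≥0) {r s : ℝ≥0} (hrs : r = 0 ∨ s = 0) :
    coneDist φ lam Δ p q (Cone.mk t r) (Cone.mk u s) ^ q = homogCost φ 0 (r ^ p) (s ^ p) := by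
  rw [coneDist, ← ENNReal.rpow_mul, one_div, inv_mul_cancel₀ hq.ne', ENNReal.rpow_one]
  refine le_antisymm ?_ ?_
  · obtain ⟨v, hr, hs⟩ : ∃ v, Cone.mk v r = Cone.mk t r ∧ Cone.mk v s = Cone.mk u s := by
      rcases hrs with h | h
      · exact ⟨u, Cone.mk_eq_mk.2 (Or.inr ⟨h, h⟩), rfl⟩
      · exact ⟨t, rfl, Cone.mk_eq_mk.2 (Or.inr ⟨h, h⟩)⟩
    rw [← h0 v]
    exact iInf_le_of_le v <| iInf_le_of_le r <| iInf_le_of_le hr <| iInf_le_of_le v <|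
      iInf_le_of_le s <| iInf_le_of_le hs le_rfl
  · refine le_iInf fun t' => le_iInf fun r' => le_iInf fun hr => le_iInf fun u' =>
      le_iInf fun s' => le_iInf fun hs => ?_
    obtain rfl : r' = r := congrArg Cone.radius hr
    obtain rfl : s' = s := congrArg Cone.radius hs
    exact homogCost_mono φ zero_le _ _

theorem coneDist_mk_rpow_eq_coneKernel {φ lam : ℝ≥0 → ℝ≥0∞} {Δ : ℝ≥0 → ℝ≥0 → ℝ≥0} {p q : ℝ}
    (h0 : ∀ t, lam (Δ t t) = 0) (hp : 0 < p) (hq : 0 < q) (t r u s : ℝ≥0) :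
    coneDist φ lam Δ p q (Cone.mk t r) (Cone.mk u s) ^ q =
      coneKernel φ (fun t u => lam (Δ t u)) t u (r ^ p) (s ^ p) := by
  have hpow : ∀ x : ℝ≥0, x ^ p = 0 ↔ x = 0 := fun x => by simp [NNReal.rpow_eq_zero_iff, hp.ne']
  by_cases hrs : r = 0 ∨ s = 0
  · rw [coneKernel, if_pos (by simpa only [hpow] using hrs),
      coneDist_mk_rpow_of_eq_zero h0 hq t u hrs]
  · rw [coneKernel, if_neg (by simpa only [hpow] using hrs)]
    push Not at hrs
    exact coneDist_mk_rpow_of_pos φ lam Δ p q hq t r u s (pos_of_ne_zero hrs.1)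
      (pos_of_ne_zero hrs.2)

theorem coneKernel_rpow_eq_coneDist {φ lam : ℝ≥0 → ℝ≥0∞} {Δ : ℝ≥0 → ℝ≥0 → ℝ≥0} {p q : ℝ}
    (h0 : ∀ t, lam (Δ t t) = 0) (hp : 0 < p) (hq : 0 < q) (t u a b : ℝ≥0) :
    coneKernel φ (fun t u => lam (Δ t u)) t u a b ^ (1 / q) =
      coneDist φ lam Δ p q (Cone.mk t (a ^ p⁻¹)) (Cone.mk u (b ^ p⁻¹)) := by
  have h := coneDist_mk_rpow_eq_coneKernel (φ := φ) h0 hp hq t (a ^ p⁻¹) u (b ^ p⁻¹)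
  rw [NNReal.rpow_inv_rpow hp.ne', NNReal.rpow_inv_rpow hp.ne'] at h
  rw [← h, one_div, ENNReal.rpow_rpow_inv hq.ne']

end ConeKernel

/-! ### Reweighted measures -/

section Reweight

variable {S T U : Type*} [MeasurableSpace S] [MeasurableSpace T] [MeasurableSpace U]

/-- The image under `F` of the measure with density `ω` with respect to `α`. It only depends on the
cone points `[F s, ω s]`. With `ω` the weight and `F` the base point of a point of a cone, this is
the conic marginal of `α`. -/
def reweight (ω : S → ℝ≥0) (F : S → T) (α : Measure S) : Measure T :=
  (α.withDensity fun s => (ω s : ℝ≥0∞)).map F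

variable {α : Measure S} {ω : S → ℝ≥0} {F : S → T}

theorem lintegral_reweight (hω : Measurable ω) (hF : Measurable F) {g : T → ℝ≥0∞}
    (hg : Measurable g) : ∫⁻ z, g z ∂(reweight ω F α) = ∫⁻ s, ω s * g (F s) ∂α := by
  rw [reweight, lintegral_map hg hF]
  exact lintegral_withDensity_eq_lintegral_mul _ hω.coe_nnreal_ennreal (hg.comp hF)

theorem reweight_one (F : S → T) (α : Measure S) : reweight (fun _ => 1) F α = α.map F := by
  simp [reweight]

theorem reweight_eq_zero (hω : Measurable ω) (F : S → T) (h : ∀ᵐ s ∂α, ω s = 0) :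
    reweight ω F α = 0 := by
  have hzero : (fun s => (ω s : ℝ≥0∞)) =ᵐ[α] 0 := by
    filter_upwards [h] with s hs
    simp [hs]
  rw [reweight, (withDensity_eq_zero_iff hω.coe_nnreal_ennreal.aemeasurable).2 hzero,
    Measure.map_zero]

theorem reweight_add (ω : S → ℝ≥0) (hF : Measurable F) (α β : Measure S) :
    reweight ω F (α + β) = reweight ω F α + reweight ω F β := by
  rw [reweight, withDensity_add_measure, Measure.map_add _ _ hF]
  rfl

theorem reweight_map {G : S → T} (hG : Measurable G) {ω : T → ℝ≥0} (hω : Measurable ω)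
    {F : T → U} (hF : Measurable F) :
    reweight ω F (α.map G) = reweight (fun s => ω (G s)) (fun s => F (G s)) α := by
  refine Measure.ext_of_lintegral _ fun g hg => ?_
  rw [lintegral_reweight hω hF hg, lintegral_reweight (by fun_prop) (by fun_prop) hg,
    lintegral_map (by fun_prop) hG]

theorem reweight_reweight (hω : Measurable ω) (hF : Measurable F) {ω' : T → ℝ≥0}
    (hω' : Measurable ω') {F' : T → U} (hF' : Measurable F') :
    reweight ω' F' (reweight ω F α) =
      reweight (fun s => ω s * ω' (F s)) (fun s => F' (F s)) α := by
  refine Measure.ext_of_lintegral _ fun g hg => ?_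
  rw [lintegral_reweight hω' hF' hg, lintegral_reweight hω hF (by fun_prop),
    lintegral_reweight (by fun_prop) (by fun_prop) hg]
  simp only [ENNReal.coe_mul, mul_assoc]

theorem reweight_congr (hω : Measurable ω) (hF : Measurable F) {ω' : S → ℝ≥0}
    (hω' : Measurable ω') {F' : S → T} (hF' : Measurable F')
    (h : ∀ s, Cone.mk (F s) (ω s) = Cone.mk (F' s) (ω' s)) : reweight ω F α = reweight ω' F' α := by
  refine Measure.ext_of_lintegral _ fun g hg => ?_
  rw [lintegral_reweight hω hF hg, lintegral_reweight hω' hF' hg]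
  refine lintegral_congr fun s => ?_
  rcases Cone.mk_eq_mk.1 (h s) with ⟨hFs, hωs⟩ | ⟨hωs, hωs'⟩
  · rw [hFs, hωs]
  · simp [hωs, hωs']

end Reweight

/-! ### Plans in weighted coordinates -/

section WeightedPlan

/-- Pairs of weighted points: `((x, a), (y, b))` stands for the pair of cone points `[x, r]` and
`[y, s]` with `a = r ^ p` and `b = s ^ p`, so that the exponent disappears from the problem. -/
abbrev WeightedPair (X Y : Type*) := (X × ℝ≥0) × (Y × ℝ≥0)

/-- The pair of points of the cones with the given weights as radii. -/
def WeightedPair.toCone {X Y : Type*} (w : WeightedPair X Y) : Cone X × Cone Y :=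
  (Cone.mk w.1.1 w.1.2, Cone.mk w.2.1 w.2.2)

/-- Multiplication of both weights by `k`. -/
def WeightedPair.scale {X Y : Type*} (k : ℝ≥0) (w : WeightedPair X Y) : WeightedPair X Y :=
  ((w.1.1, k * w.1.2), (w.2.1, k * w.2.2))

variable {K : ℝ≥0 → ℝ≥0 → ℝ≥0 → ℝ≥0 → ℝ≥0∞} {X Y : Type*}

section Cost

variable [MetricSpace X] [MetricSpace Y]

/-- The cost `K([d(x, x'), a a'], [d(y, y'), b b'])` of a pair of points of `WeightedPair X Y`. -/
def pairCost (K : ℝ≥0 → ℝ≥0 → ℝ≥0 → ℝ≥0 → ℝ≥0∞) (w z : WeightedPair X Y) : ℝ≥0∞ :=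
  K (nndist w.1.1 z.1.1) (nndist w.2.1 z.2.1) (w.1.2 * z.1.2) (w.2.2 * z.2.2)

theorem IsConeKernel.lowerSemicontinuous_pairCost (hK : IsConeKernel K) :
    LowerSemicontinuous fun v : WeightedPair X Y × WeightedPair X Y => pairCost K v.1 v.2 := by
  have hcont : Continuous fun v : WeightedPair X Y × WeightedPair X Y =>
      ((nndist v.1.1.1 v.2.1.1, nndist v.1.2.1 v.2.2.1),
        (v.1.1.2 * v.2.1.2, v.1.2.2 * v.2.2.2)) := by fun_prop
  exact hK.lsc.comp hcont

theorem IsConeKernel.pairCost_congr (hK : IsConeKernel K) {w w' z z' : WeightedPair X Y}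
    (hw : w.toCone = w'.toCone) (hz : z.toCone = z'.toCone) :
    pairCost K w z = pairCost K w' z' :=
  hK.congr (congrArg₂ Cone.pair (Prod.ext_iff.1 hw).1 (Prod.ext_iff.1 hz).1)
    (congrArg₂ Cone.pair (Prod.ext_iff.1 hw).2 (Prod.ext_iff.1 hz).2)

theorem IsConeKernel.pairCost_scale (hK : IsConeKernel K) (k k' : ℝ≥0) (w z : WeightedPair X Y) :
    pairCost K (w.scale k) (z.scale k') = k * (k' * pairCost K w z) := by
  simp only [pairCost, WeightedPair.scale]
  rw [mul_mul_mul_comm, mul_mul_mul_comm k w.2.2, hK.homog, ENNReal.coe_mul, mul_assoc]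

theorem IsConeKernel.pairCost_swap (hK : IsConeKernel K) (w z : WeightedPair X Y) :
    pairCost K w.swap z.swap = pairCost K w z :=
  hK.symm _ _ _ _

end Cost

section Plan

variable [MeasurableSpace X] [MeasurableSpace Y]

/-- The finite measures on `WeightedPair X Y` with conic marginals `μ` and `ν`. -/
structure IsWeightedPlan (μ : Measure X) (ν : Measure Y) (α : Measure (WeightedPair X Y)) :
    Prop where
  finite : IsFiniteMeasure α
  left : reweight (fun w => w.1.2) (fun w => w.1.1) α = μ
  right : reweight (fun w => w.2.2) (fun w => w.2.1) α = ν

variable {μ : Measure X} {ν : Measure Y} {α : Measure (WeightedPair X Y)}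

theorem IsWeightedPlan.swap (hα : IsWeightedPlan μ ν α) :
    IsWeightedPlan ν μ (α.map Prod.swap) where
  finite := have := hα.finite; inferInstance
  left := by
    rw [← hα.right, reweight_map measurable_swap (by fun_prop) (by fun_prop)]
    rfl
  right := by
    rw [← hα.left, reweight_map measurable_swap (by fun_prop) (by fun_prop)]
    rfl

theorem IsWeightedPlan.reweight (hα : IsWeightedPlan μ ν α) {ω : WeightedPair X Y → ℝ≥0}
    (hω : Measurable ω) {F : WeightedPair X Y → WeightedPair X Y} (hF : Measurable F)
    (h : ∀ w, ((F w).scale (ω w)).toCone = w.toCone) (hfin : ∫⁻ w, ω w ∂α ≠ ∞) :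
    IsWeightedPlan μ ν (reweight ω F α) where
  finite := have := isFiniteMeasure_withDensity hfin; Measure.isFiniteMeasure_map _ _
  left := by
    rw [← hα.left, reweight_reweight hω hF (by fun_prop) (by fun_prop)]
    exact reweight_congr (by fun_prop) (by fun_prop) (by fun_prop) (by fun_prop)
      fun w => (Prod.ext_iff.1 (h w)).1
  right := by
    rw [← hα.right, reweight_reweight hω hF (by fun_prop) (by fun_prop)]
    exact reweight_congr (by fun_prop) (by fun_prop) (by fun_prop) (by fun_prop)
      fun w => (Prod.ext_iff.1 (h w)).2

end Plan

section Energy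

variable [MetricSpace X] [MetricSpace Y] [MeasurableSpace X] [MeasurableSpace Y]

/-- The integral of the pair cost against the product of a measure with itself. -/
def energy (K : ℝ≥0 → ℝ≥0 → ℝ≥0 → ℝ≥0 → ℝ≥0∞) (α : Measure (WeightedPair X Y)) : ℝ≥0∞ :=
  ∫⁻ w, ∫⁻ z, pairCost K w z ∂α ∂α

/-- The conic Gromov–Wasserstein divergence in weighted coordinates, for arbitrary measures on
metric spaces and an arbitrary cost on the cone over `ℝ₊`. -/
def divergence (K : ℝ≥0 → ℝ≥0 → ℝ≥0 → ℝ≥0 → ℝ≥0∞) (μ : Measure X) (ν : Measure Y) : ℝ≥0∞ :=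
  ⨅ (α : Measure (WeightedPair X Y)) (_ : IsWeightedPlan μ ν α), energy K α

variable [BorelSpace X] [BorelSpace Y] [SecondCountableTopology X] [SecondCountableTopology Y]

theorem IsConeKernel.measurable_pairCost (hK : IsConeKernel K) :
    Measurable fun v : WeightedPair X Y × WeightedPair X Y => pairCost K v.1 v.2 :=
  hK.lowerSemicontinuous_pairCost.measurable

theorem IsConeKernel.energy_map (hK : IsConeKernel K) {S : Type*} [MeasurableSpace S]
    (α : Measure S) [SFinite α] {F : S → WeightedPair X Y} (hF : Measurable F) :
    energy K (α.map F) = ∫⁻ s, ∫⁻ t, pairCost K (F s) (F t) ∂α ∂α := by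
  rw [energy, lintegral_map hK.measurable_pairCost.lintegral_prod_right' hF]
  exact lintegral_congr fun s =>
    lintegral_map (hK.measurable_pairCost.comp measurable_prodMk_left) hF

theorem IsConeKernel.energy_map_swap (hK : IsConeKernel K) (α : Measure (WeightedPair X Y))
    [SFinite α] : energy K (α.map Prod.swap) = energy K α := by
  rw [hK.energy_map α measurable_swap]
  simp only [hK.pairCost_swap]
  rfl

theorem IsConeKernel.energy_reweight (hK : IsConeKernel K) (α : Measure (WeightedPair X Y))
    [SFinite α] {ω : WeightedPair X Y → ℝ≥0} (hω : Measurable ω)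
    {F : WeightedPair X Y → WeightedPair X Y} (hF : Measurable F)
    (h : ∀ w, ((F w).scale (ω w)).toCone = w.toCone) :
    energy K (reweight ω F α) = energy K α := by
  have : SFinite (reweight ω F α) := by unfold reweight; infer_instance
  rw [energy, lintegral_reweight hω hF hK.measurable_pairCost.lintegral_prod_right', energy]
  refine lintegral_congr fun w => ?_
  have hcost : Measurable (pairCost K (F w)) := hK.measurable_pairCost.comp measurable_prodMk_left
  rw [lintegral_reweight hω hF hcost, ← lintegral_const_mul _ (by fun_prop)]
  exact lintegral_congr fun z =>
    (hK.pairCost_scale _ _ _ _).symm.trans (hK.pairCost_congr (h w) (h z))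

theorem IsConeKernel.divergence_le_swap (hK : IsConeKernel K) (μ : Measure X) (ν : Measure Y) :
    divergence K μ ν ≤ divergence K ν μ := by
  refine le_iInf₂ fun α hα => ?_
  have := hα.finite
  exact (iInf₂_le (α.map Prod.swap) hα.swap).trans_eq (hK.energy_map_swap α)

end Energy

end WeightedPlan

theorem IsConeKernel.divergence_comm {K : ℝ≥0 → ℝ≥0 → ℝ≥0 → ℝ≥0 → ℝ≥0∞} (hK : IsConeKernel K)
    {X Y : Type*} [MetricSpace X] [MetricSpace Y] [MeasurableSpace X] [MeasurableSpace Y]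
    [BorelSpace X] [BorelSpace Y] [SecondCountableTopology X] [SecondCountableTopology Y]
    (μ : Measure X) (ν : Measure Y) : divergence K μ ν = divergence K ν μ :=
  le_antisymm (hK.divergence_le_swap μ ν) (hK.divergence_le_swap ν μ)

/-! ### Weighted coordinates on the cone -/

theorem Cone.measurable_mk {X : Type*} [MeasurableSpace X] :
    Measurable fun a : X × ℝ≥0 => Cone.mk a.1 a.2 :=
  measurable_quotient_mk' (s := coneSetoid X)

section Rep

variable {X : Type*} [Nonempty X]

/-- The representative `(x, r)` of a cone point, with a fixed `x` for the apex. -/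
def Cone.rep : Cone X → X × ℝ≥0 :=
  Quotient.lift (fun a : X × ℝ≥0 => if a.2 = 0 then (Classical.arbitrary X, 0) else a) (by
    rintro a b (rfl | ⟨h, h'⟩)
    · rfl
    · simp [h, h'])

theorem Cone.rep_mk (x : X) (r : ℝ≥0) :
    (Cone.mk x r).rep = if r = 0 then (Classical.arbitrary X, 0) else (x, r) := rfl

theorem Cone.rep_mk_snd (x : X) (r : ℝ≥0) : (Cone.mk x r).rep.2 = r := by
  rw [Cone.rep_mk]
  split_ifs with h <;> simp [h]

theorem Cone.rep_mk_fst (x : X) {r : ℝ≥0} (hr : r ≠ 0) : (Cone.mk x r).rep.1 = x := by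
  rw [Cone.rep_mk, if_neg hr]

theorem Cone.mk_rep (c : Cone X) : Cone.mk c.rep.1 c.rep.2 = c := by
  induction c using Quotient.inductionOn with
  | h a =>
    by_cases h : a.2 = 0
    · exact Cone.mk_eq_mk.2 (Or.inr ⟨(Cone.rep_mk_snd a.1 a.2).trans h, h⟩)
    · exact Cone.mk_eq_mk.2 (Or.inl ⟨Cone.rep_mk_fst a.1 h, Cone.rep_mk_snd a.1 a.2⟩)

theorem Cone.radius_eq (c : Cone X) : c.radius = c.rep.2 := by
  conv_lhs => rw [← c.mk_rep]
  rfl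

theorem Cone.pair_eq {X : Type*} [MetricSpace X] [Nonempty X] (c d : Cone X) :
    Cone.pair c d = Cone.mk (nndist c.rep.1 d.rep.1) (c.rep.2 * d.rep.2) := by
  conv_lhs => rw [← c.mk_rep, ← d.mk_rep]
  rfl

/-- The weighted point `(x, r ^ p)` of a cone point `[x, r]`. -/
def Cone.toWeighted (p : ℝ) (c : Cone X) : X × ℝ≥0 := (c.rep.1, c.rep.2 ^ p)

/-- The cone point `[x, a ^ (1 / p)]` of a weighted point `(x, a)`. -/
def Cone.ofWeighted {X : Type*} (p : ℝ) (a : X × ℝ≥0) : Cone X := Cone.mk a.1 (a.2 ^ p⁻¹)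

theorem Cone.mk_toWeighted_ofWeighted {p : ℝ} (hp : 0 < p) (a : X × ℝ≥0) :
    Cone.mk (Cone.toWeighted p (Cone.ofWeighted p a)).1
      (Cone.toWeighted p (Cone.ofWeighted p a)).2 = Cone.mk a.1 a.2 := by
  have hsnd : (Cone.toWeighted p (Cone.ofWeighted p a)).2 = a.2 := by
    rw [Cone.toWeighted, Cone.ofWeighted, Cone.rep_mk_snd, NNReal.rpow_inv_rpow hp.ne']
  rw [hsnd, Cone.mk_eq_mk]
  by_cases ha : a.2 = 0
  · exact Or.inr ⟨ha, ha⟩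
  · exact Or.inl ⟨Cone.rep_mk_fst _ (by simp [NNReal.rpow_eq_zero_iff, ha]), rfl⟩

theorem Cone.mk_mem_image_prod_univ {X : Type*} {A : Set X} {x : X} {r : ℝ≥0} :
    Cone.mk x r ∈ (fun a : X × ℝ≥0 => Cone.mk a.1 a.2) '' (A ×ˢ univ) ↔
      x ∈ A ∨ (r = 0 ∧ A.Nonempty) := by
  constructor
  · rintro ⟨⟨y, s⟩, ⟨hy, -⟩, h⟩
    rcases Cone.mk_eq_mk.1 h with ⟨rfl, -⟩ | ⟨-, h⟩
    · exact Or.inl hy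
    · exact Or.inr ⟨h, _, hy⟩
  · rintro (h | ⟨h, y, hy⟩)
    · exact ⟨(x, r), ⟨h, mem_univ _⟩, rfl⟩
    · exact ⟨(y, 0), ⟨hy, mem_univ _⟩, Cone.mk_eq_mk.2 (Or.inr ⟨rfl, h⟩)⟩

variable [MeasurableSpace X]

@[fun_prop]
theorem Cone.measurable_rep : Measurable (Cone.rep : Cone X → X × ℝ≥0) := by
  refine (measurable_from_quotient (s := coneSetoid X)).2 ?_
  change Measurable fun a : X × ℝ≥0 => if a.2 = 0 then (Classical.arbitrary X, 0) else a
  exact Measurable.ite (measurable_snd (measurableSet_singleton 0)) measurable_const measurable_id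

@[fun_prop]
theorem Cone.measurable_toWeighted (p : ℝ) : Measurable (Cone.toWeighted p : Cone X → X × ℝ≥0) :=
  Cone.measurable_rep.fst.prodMk (Cone.measurable_rep.snd.pow_const p)

@[fun_prop]
theorem Cone.measurable_ofWeighted {X : Type*} [MeasurableSpace X] (p : ℝ) :
    Measurable (Cone.ofWeighted p : X × ℝ≥0 → Cone X) :=
  Cone.measurable_mk.comp (f := fun a : X × ℝ≥0 => (a.1, a.2 ^ p⁻¹)) (by fun_prop)

theorem Cone.measurableSet_image_prod_univ {X : Type*} [MeasurableSpace X] {A : Set X}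
    (hA : MeasurableSet A) :
    MeasurableSet ((fun a : X × ℝ≥0 => Cone.mk a.1 a.2) '' (A ×ˢ univ)) := by
  refine (measurableSet_quotient (s := coneSetoid X)).2 ?_
  change MeasurableSet {a : X × ℝ≥0 | Cone.mk a.1 a.2 ∈ _}
  simp only [Cone.mk_mem_image_prod_univ]
  exact (measurable_fst hA).union
    ((measurable_snd (measurableSet_singleton (0 : ℝ≥0))).inter (MeasurableSet.const _))

theorem Cone.setLIntegral_radius_rpow {p : ℝ} (hp : 0 < p) (β : Measure (Cone X)) {A : Set X}
    (hA : MeasurableSet A) :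
    ∫⁻ c in (fun a : X × ℝ≥0 => Cone.mk a.1 a.2) '' (A ×ˢ univ),
        ((c.radius ^ p : ℝ≥0) : ℝ≥0∞) ∂β =
      ∫⁻ c, (c.toWeighted p).2 * A.indicator 1 (c.toWeighted p).1 ∂β := by
  rw [← lintegral_indicator (Cone.measurableSet_image_prod_univ hA)]
  refine lintegral_congr fun c => ?_
  obtain ⟨x, r, rfl⟩ : ∃ x r, Cone.mk x r = c := ⟨_, _, c.mk_rep⟩
  by_cases hr : r = 0
  · simp [indicator, Cone.radius_eq, Cone.toWeighted, Cone.rep_mk_snd, hr, hp.ne']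
  · classical
    simp only [indicator_apply, Cone.mk_mem_image_prod_univ, hr, false_and, or_false,
      Cone.radius_eq, Cone.toWeighted, Cone.rep_mk_snd, Cone.rep_mk_fst x hr, Pi.one_apply]
    by_cases hx : x ∈ A <;> simp [hx]

theorem hasConicMarginal_iff {p : ℝ} (hp : 0 < p) (β : Measure (Cone X)) (μ : Measure X) :
    HasConicMarginal p β μ ↔
      reweight (fun c => (c.toWeighted p).2) (fun c => (c.toWeighted p).1) β = μ := by
  have hweight := (Cone.measurable_toWeighted (X := X) p).snd
  have hbase := (Cone.measurable_toWeighted (X := X) p).fst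
  have happly : ∀ A, MeasurableSet A →
      ∫⁻ c in (fun a : X × ℝ≥0 => Cone.mk a.1 a.2) '' (A ×ˢ univ),
        ((c.radius ^ p : ℝ≥0) : ℝ≥0∞) ∂β =
      reweight (fun c => (c.toWeighted p).2) (fun c => (c.toWeighted p).1) β A := by
    intro A hA
    rw [Cone.setLIntegral_radius_rpow hp β hA, ← lintegral_indicator_one hA,
      lintegral_reweight hweight hbase (measurable_one.indicator hA)]
  rw [Measure.ext_iff]
  exact forall₂_congr fun A hA => by rw [happly A hA]

end Rep

/-! ### The divergence in weighted coordinates -/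

section Divergence

variable {φ lam : ℝ≥0 → ℝ≥0∞} {Δ : ℝ≥0 → ℝ≥0 → ℝ≥0} {p q : ℝ}
  {K : ℝ≥0 → ℝ≥0 → ℝ≥0 → ℝ≥0 → ℝ≥0∞} {X Y : MMSpace.{u}}

theorem conicFunctional_eq_energy (hK : IsConeKernel K)
    (hD : ∀ t r u s, coneDist φ lam Δ p q (Cone.mk t r) (Cone.mk u s) ^ q =
      K t u (r ^ p) (s ^ p))
    (α : Measure (Cone X.carrier × Cone Y.carrier)) [SFinite α] :
    conicFunctional φ lam Δ p q α =
      energy K (α.map (Prod.map (Cone.toWeighted p) (Cone.toWeighted p))) := by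
  rw [hK.energy_map α ((Cone.measurable_toWeighted p).prodMap (Cone.measurable_toWeighted p)),
    conicFunctional]
  refine lintegral_congr fun w => lintegral_congr fun z => ?_
  rw [Cone.pair_eq, Cone.pair_eq, hD, NNReal.mul_rpow, NNReal.mul_rpow]
  rfl

theorem isWeightedPlan_map_toWeighted (hp : 0 < p)
    {α : Measure (Cone X.carrier × Cone Y.carrier)} (hα : α ∈ conicPlans p X Y) :
    IsWeightedPlan X.meas Y.meas (α.map (Prod.map (Cone.toWeighted p) (Cone.toWeighted p))) := by
  obtain ⟨hfin, hleft, hright⟩ := hα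
  have hmap := (Cone.measurable_toWeighted (X := X.carrier) p).prodMap
    (Cone.measurable_toWeighted (X := Y.carrier) p)
  refine ⟨inferInstance, ?_, ?_⟩
  · rw [← (hasConicMarginal_iff hp _ _).1 hleft, reweight_map hmap (by fun_prop) (by fun_prop),
      Measure.fst, reweight_map measurable_fst (Cone.measurable_toWeighted p).snd
        (Cone.measurable_toWeighted p).fst]
    rfl
  · rw [← (hasConicMarginal_iff hp _ _).1 hright, reweight_map hmap (by fun_prop) (by fun_prop),
      Measure.snd, reweight_map measurable_snd (Cone.measurable_toWeighted p).snd
        (Cone.measurable_toWeighted p).fst]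
    rfl

theorem map_ofWeighted_mem_conicPlans (hp : 0 < p)
    {α : Measure (WeightedPair X.carrier Y.carrier)} (hα : IsWeightedPlan X.meas Y.meas α) :
    α.map (Prod.map (Cone.ofWeighted p) (Cone.ofWeighted p)) ∈ conicPlans p X Y := by
  have := hα.finite
  have hX := Cone.measurable_toWeighted (X := X.carrier) p
  have hY := Cone.measurable_toWeighted (X := Y.carrier) p
  have hX' := Cone.measurable_ofWeighted (X := X.carrier) p
  have hY' := Cone.measurable_ofWeighted (X := Y.carrier) p
  refine ⟨inferInstance, ?_, ?_⟩
  · rw [hasConicMarginal_iff hp, ← hα.left, Measure.fst, reweight_map measurable_fst hX.snd hX.fst,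
      reweight_map (hX'.prodMap hY') (by fun_prop) (by fun_prop)]
    exact reweight_congr (by fun_prop) (by fun_prop) (by fun_prop) (by fun_prop)
      fun w => Cone.mk_toWeighted_ofWeighted hp w.1
  · rw [hasConicMarginal_iff hp, ← hα.right, Measure.snd, reweight_map measurable_snd hY.snd hY.fst,
      reweight_map (hX'.prodMap hY') (by fun_prop) (by fun_prop)]
    exact reweight_congr (by fun_prop) (by fun_prop) (by fun_prop) (by fun_prop)
      fun w => Cone.mk_toWeighted_ofWeighted hp w.2

theorem CGW_eq_divergence (hK : IsConeKernel K)
    (hD : ∀ t r u s, coneDist φ lam Δ p q (Cone.mk t r) (Cone.mk u s) ^ q =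
      K t u (r ^ p) (s ^ p)) (hp : 0 < p) (X Y : MMSpace.{u}) :
    CGW φ lam Δ p q X Y = divergence K X.meas Y.meas := by
  refine le_antisymm (le_iInf₂ fun α hα => ?_) (le_iInf₂ fun α hα => ?_)
  · have := hα.finite
    have hto := (Cone.measurable_toWeighted (X := X.carrier) p).prodMap
      (Cone.measurable_toWeighted (X := Y.carrier) p)
    have hof := (Cone.measurable_ofWeighted (X := X.carrier) p).prodMap
      (Cone.measurable_ofWeighted (X := Y.carrier) p)
    have hcone : ∀ w : WeightedPair X.carrier Y.carrier, WeightedPair.toCone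
        (Prod.map (Cone.toWeighted p) (Cone.toWeighted p)
          (Prod.map (Cone.ofWeighted p) (Cone.ofWeighted p) w)) = w.toCone := fun w =>
      Prod.ext (Cone.mk_toWeighted_ofWeighted hp w.1) (Cone.mk_toWeighted_ofWeighted hp w.2)
    refine (iInf₂_le _ (map_ofWeighted_mem_conicPlans hp hα)).trans_eq ?_
    rw [conicFunctional_eq_energy hK hD, Measure.map_map hto hof,
      hK.energy_map α (hto.comp hof), energy]
    exact lintegral_congr fun w => lintegral_congr fun z => hK.pairCost_congr (hcone w) (hcone z)
  · have := hα.1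
    exact (iInf₂_le _ (isWeightedPlan_map_toWeighted hp hα)).trans_eq
      (conicFunctional_eq_energy hK hD α).symm

end Divergence

/-! ### Supports of image measures -/

section Support

variable {W X : Type*} [MeasurableSpace W] [MeasurableSpace X]

theorem image_support_subset_support_map [TopologicalSpace W] [OpensMeasurableSpace W]
    [TopologicalSpace X] [BorelSpace X] {f : W → X} (hf : Continuous f) (γ : Measure W) :
    f '' γ.support ⊆ (γ.map f).support := by
  rintro _ ⟨w, hw, rfl⟩
  rw [Measure.mem_support_iff_forall] at hw ⊢
  exact fun U hU =>
    (hw _ (hf.continuousAt hU)).trans_le (Measure.le_map_apply hf.aemeasurable U)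

theorem support_map_eq_image [TopologicalSpace W] [OpensMeasurableSpace W]
    [HereditarilyLindelofSpace W] [TopologicalSpace X] [BorelSpace X] {f : W → X}
    (hf : Continuous f) {γ : Measure W} (hclosed : IsClosed (f '' γ.support)) :
    (γ.map f).support = f '' γ.support := by
  refine (Measure.support_subset_of_isClosed hclosed ?_).antisymm
    (image_support_subset_support_map hf γ)
  rw [mem_ae_iff, Measure.map_apply hf.measurable hclosed.measurableSet.compl]
  exact measure_mono_null (fun w hw hw' => hw ⟨w, hw', rfl⟩) Measure.measure_compl_support

theorem map_val_comap_val_support [TopologicalSpace W] [OpensMeasurableSpace W]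
    [HereditarilyLindelofSpace W] (γ : Measure W) :
    (γ.comap (Subtype.val : γ.support → W)).map Subtype.val = γ := by
  rw [map_comap_subtype_coe Measure.isClosed_support.measurableSet]
  exact Measure.restrict_eq_self_of_ae_mem (s := γ.support) Measure.support_mem_ae

theorem exists_isometryEquiv_support_map [MetricSpace W] [CompleteSpace W]
    [SecondCountableTopology W] [BorelSpace W] [MetricSpace X] [BorelSpace X]
    {f : W → X} (hf : Continuous f) (γ : Measure W)
    (hdist : ∀ w ∈ γ.support, ∀ z ∈ γ.support, dist (f w) (f z) = dist w z) :
    ∃ e : γ.support ≃ᵢ (γ.map f).support,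
      (γ.comap (Subtype.val : γ.support → W)).map e =
        (γ.map f).comap (Subtype.val : (γ.map f).support → X) := by
  have hiso : Isometry fun w : γ.support => f w :=
    Isometry.of_dist_eq fun w z => hdist w w.2 z z.2
  have : CompleteSpace γ.support := Measure.isClosed_support.completeSpace_coe
  have himage : (γ.map f).support = f '' γ.support := by
    refine support_map_eq_image hf ?_
    rw [image_eq_range]
    exact hiso.isClosedEmbedding.isClosed_range
  let e : γ.support ≃ᵢ (γ.map f).support :=
    hiso.isometryEquivOnRange.trans
      (IsometryEquiv.mk (Equiv.setCongr (by rw [himage, image_eq_range])) fun _ _ => rfl)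
  have hval : ((γ.comap (Subtype.val : γ.support → W)).map e).map Subtype.val = γ.map f := by
    rw [Measure.map_map measurable_subtype_coe e.continuous.measurable]
    change (γ.comap (Subtype.val : γ.support → W)).map (f ∘ Subtype.val) = _
    rw [← Measure.map_map hf.measurable measurable_subtype_coe, map_val_comap_val_support]
  have hemb := MeasurableEmbedding.subtype_coe
    (Measure.isClosed_support (μ := γ.map f)).measurableSet
  exact ⟨e, (hemb.comap_map _).symm.trans (congrArg (Measure.comap Subtype.val) hval)⟩

end Support

/-! ### Weak limits of finite measures -/

theorem measure_le_of_forall_isOpen {X : Type*} [TopologicalSpace X] [MeasurableSpace X]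
    {μ ν : Measure X} [ν.OuterRegular] (h : ∀ U, IsOpen U → μ U ≤ ν U) : μ ≤ ν := by
  refine Measure.le_iff'.2 fun A => ?_
  rw [A.measure_eq_iInf_isOpen ν]
  exact le_iInf₂ fun U hAU => le_iInf fun hU => (measure_mono hAU).trans (h U hU)

theorem mul_measure_mul_measure_le_lintegral {W : Type*} [MeasurableSpace W] (β : Measure W)
    {f : W → W → ℝ≥0∞} {c : ℝ≥0∞} {U V : Set W} (hU : MeasurableSet U) (hV : MeasurableSet V)
    (h : ∀ w ∈ U, ∀ z ∈ V, c ≤ f w z) : c * (β U * β V) ≤ ∫⁻ w, ∫⁻ z, f w z ∂β ∂β := by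
  calc c * (β U * β V) = ∫⁻ _ in U, ∫⁻ _ in V, c ∂β ∂β := by
        rw [setLIntegral_const, setLIntegral_const, mul_assoc, mul_comm (β V)]
    _ ≤ ∫⁻ w in U, ∫⁻ z in V, f w z ∂β ∂β :=
        setLIntegral_mono' hU fun w hw => setLIntegral_mono' hV (h w hw)
    _ ≤ ∫⁻ w in U, ∫⁻ z, f w z ∂β ∂β := lintegral_mono fun w => setLIntegral_le_lintegral _ _
    _ ≤ ∫⁻ w, ∫⁻ z, f w z ∂β ∂β := setLIntegral_le_lintegral _ _

section WeakLimit

variable {W ι : Type*} [TopologicalSpace W] [MeasurableSpace W] [OpensMeasurableSpace W]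
  [HasOuterApproxClosed W] {F : Filter ι} {r : ι → FiniteMeasure W} {ρ : FiniteMeasure W}

theorem eventually_lt_measure_of_tendsto (h : Tendsto r F (𝓝 ρ)) {U : Set W} (hU : IsOpen U)
    {y : ℝ≥0∞} (hy : y < (ρ : Measure W) U) : ∀ᶠ i in F, y < (r i : Measure W) U := by
  have hlt : (ρ : Measure W) Uᶜ < (ρ : Measure W) univ - y := by
    rw [lt_tsub_iff_right, ← measure_add_measure_compl hU.measurableSet, add_comm]
    exact ENNReal.add_lt_add_right (by finiteness) hy
  obtain ⟨c, hρc, hc⟩ := exists_between hlt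
  have hmass : Tendsto (fun i => (r i : Measure W) univ) F (𝓝 ((ρ : Measure W) univ)) := by
    simpa only [FiniteMeasure.ennreal_mass] using ENNReal.tendsto_coe.2 h.mass
  filter_upwards [hmass.eventually_const_lt (lt_tsub_iff_right.1 hc), eventually_lt_of_limsup_lt
    ((FiniteMeasure.limsup_measure_closed_le_of_tendsto h hU.isClosed_compl).trans_lt hρc)]
    with i hi hic
  by_contra! hle
  refine hi.not_ge ?_
  rw [← measure_add_measure_compl hU.measurableSet, add_comm]
  exact add_le_add hic.le hle

theorem measure_open_le_of_tendsto [F.NeBot] (h : Tendsto r F (𝓝 ρ)) {U : Set W} (hU : IsOpen U)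
    {C : ℝ≥0∞} (hC : ∀ i, (r i : Measure W) U ≤ C) : (ρ : Measure W) U ≤ C := by
  refine le_of_forall_lt fun y hy => ?_
  obtain ⟨i, hi⟩ := (eventually_lt_measure_of_tendsto h hU hy).exists
  exact hi.trans_le (hC i)

theorem measure_le_of_tendsto [F.NeBot] (h : Tendsto r F (𝓝 ρ)) {μ : Measure W} [μ.OuterRegular]
    (hμ : ∀ i, (r i : Measure W) ≤ μ) : (ρ : Measure W) ≤ μ :=
  measure_le_of_forall_isOpen fun U hU => measure_open_le_of_tendsto h hU fun i => hμ i U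

theorem support_subset_of_tendsto [F.NeBot] (h : Tendsto r F (𝓝 ρ)) {C : Set W} (hC : IsClosed C)
    (hr : ∀ i, ∀ᵐ w ∂(r i : Measure W), w ∈ C) : (ρ : Measure W).support ⊆ C :=
  Measure.support_subset_of_isClosed hC <|
    le_antisymm (measure_open_le_of_tendsto h hC.isOpen_compl fun i => (hr i).le) zero_le

theorem eq_zero_of_tendsto_lintegral_lintegral [F.NeBot] (h : Tendsto r F (𝓝 ρ))
    {f : W → W → ℝ≥0∞} (hf : LowerSemicontinuous fun v : W × W => f v.1 v.2)
    (hlim : Tendsto (fun i => ∫⁻ w, ∫⁻ z, f w z ∂(r i : Measure W) ∂(r i : Measure W)) F (𝓝 0))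
    {w z : W} (hw : w ∈ (ρ : Measure W).support) (hz : z ∈ (ρ : Measure W).support) :
    f w z = 0 := by
  by_contra hne
  obtain ⟨e, he0, he⟩ := exists_between (pos_of_ne_zero hne)
  obtain ⟨U, V, hU, hwU, hV, hzV, hUV⟩ := mem_nhds_prod_iff'.1 (hf (w, z) e he)
  obtain ⟨y, hy, hyU⟩ := exists_between
    ((Measure.mem_support_iff_forall w).1 hw U (hU.mem_nhds hwU))
  obtain ⟨y', hy', hyV⟩ := exists_between
    ((Measure.mem_support_iff_forall z).1 hz V (hV.mem_nhds hzV))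
  have hpos : 0 < e * (y * y') := ENNReal.mul_pos he0.ne' (mul_ne_zero hy.ne' hy'.ne')
  obtain ⟨i, ⟨hiU, hiV⟩, hi⟩ := (((eventually_lt_measure_of_tendsto h hU hyU).and
    (eventually_lt_measure_of_tendsto h hV hyV)).and (hlim.eventually_lt_const hpos)).exists
  refine hi.not_ge (le_trans ?_ (mul_measure_mul_measure_le_lintegral _ hU.measurableSet
    hV.measurableSet fun a ha b hb => (hUV (mk_mem_prod ha hb)).le))
  gcongr

end WeakLimit

theorem map_eq_of_tendsto {W X ι : Type*} [TopologicalSpace W] [MeasurableSpace W]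
    [OpensMeasurableSpace W] [TopologicalSpace X] [MeasurableSpace X] [BorelSpace X]
    [HasOuterApproxClosed X] {F : Filter ι} [F.NeBot] {r : ι → FiniteMeasure W}
    {ρ : FiniteMeasure W} (h : Tendsto r F (𝓝 ρ)) {f : W → X} (hf : Continuous f)
    {μ : Measure X} [μ.OuterRegular]
    (hle : ∀ i, (r i : Measure W).map f ≤ μ) (hμρ : μ univ ≤ (ρ : Measure W) univ) :
    (ρ : Measure W).map f = μ := by
  have hmap : (ρ : Measure W).map f ≤ μ :=
    measure_le_of_tendsto (FiniteMeasure.tendsto_map_of_tendsto_of_continuous r ρ h hf) hle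
  refine Measure.eq_of_le_of_measure_univ_eq hmap (le_antisymm (hmap univ) ?_)
  rwa [Measure.map_apply hf.measurable MeasurableSet.univ, preimage_univ]

section Tight

variable {W : Type*} [TopologicalSpace W] [MeasurableSpace W] {S : Set (Measure W)}

theorem isTightMeasureSet_of_forall_le {μ : Measure W} (hμ : IsTightMeasureSet {μ})
    (h : ∀ ρ ∈ S, ρ ≤ μ) : IsTightMeasureSet S := by
  rw [isTightMeasureSet_iff_exists_isCompact_measure_compl_le] at hμ ⊢
  intro ε hε
  obtain ⟨C, hC, hle⟩ := hμ ε hε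
  exact ⟨C, hC, fun ρ hρ => (h ρ hρ _).trans (hle μ rfl)⟩

theorem isTightMeasureSet_of_forall_ae_mem {C : Set W} (hC : IsCompact C)
    (h : ∀ ρ ∈ S, ∀ᵐ w ∂ρ, w ∈ C) : IsTightMeasureSet S :=
  isTightMeasureSet_iff_exists_isCompact_measure_compl_le.2 fun _ _ =>
    ⟨C, hC, fun ρ hρ => (mem_ae_iff.1 (h ρ hρ)).trans_le zero_le⟩

theorem isTightMeasureSet_prod_of_forall_le {X : Type*} [TopologicalSpace X] [MeasurableSpace X]
    {S : Set (Measure (X × W))} {μ : Measure X} (hμ : IsTightMeasureSet {μ})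
    (hfst : ∀ ρ ∈ S, ρ.fst ≤ μ) {C : Set W} (hC : IsCompact C) (hmeas : MeasurableSet C)
    (hsnd : ∀ ρ ∈ S, ∀ᵐ w ∂ρ, w.2 ∈ C) : IsTightMeasureSet S := by
  refine .prodMk (isTightMeasureSet_of_forall_le hμ (forall_mem_image.2 hfst))
    (isTightMeasureSet_of_forall_ae_mem hC (forall_mem_image.2 fun ρ hρ => ?_))
  exact (ae_map_iff measurable_snd.aemeasurable hmeas).2 (hsnd ρ hρ)

theorem exists_tendsto_of_isTightMeasureSet [T2Space W] [NormalSpace W] [BorelSpace W] {ι : Type*}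
    {r : ι → FiniteMeasure W} {m : ℝ≥0} (hmass : ∀ i, (r i).mass ≤ m)
    (htight : IsTightMeasureSet (range fun i => (r i : Measure W))) (F : Ultrafilter ι) :
    ∃ ρ, Tendsto r F (𝓝 ρ) := by
  have hcompact : ∀ k : ℕ, ∃ C : Set W, IsCompact C ∧ ∀ i, r i Cᶜ ≤ 1 / ((k : ℝ≥0) + 1) := by
    intro k
    obtain ⟨C, hC, hle⟩ := isTightMeasureSet_iff_exists_isCompact_measure_compl_le.1 htight
      ((1 / ((k : ℝ≥0) + 1) : ℝ≥0) : ℝ≥0∞) (ENNReal.coe_pos.2 (by positivity))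
    refine ⟨C, hC, fun i => ?_⟩
    rw [← ENNReal.coe_le_coe, FiniteMeasure.ennreal_coeFn_eq_coeFn_toMeasure]
    exact hle _ (mem_range_self i)
  choose C hC hle using hcompact
  have hlim : Tendsto (fun k : ℕ => 1 / ((k : ℝ≥0) + 1)) atTop (𝓝 0) :=
    tendsto_one_div_add_atTop_nhds_zero_nat
  obtain ⟨ρ, -, hρ⟩ := (isCompact_setOfPred_finiteMeasure_mass_le_compl_isCompact_le m hlim hC
    (Or.inl inferInstance)).ultrafilter_le_nhds (F.map r)
      (le_principal_iff.2 (mem_map.2 (univ_mem' fun i => ⟨hmass i, fun k => hle k i⟩)))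
  exact ⟨ρ, hρ⟩

end Tight

/-! ### Vanishing divergence forces isometry -/

section Vanishing

variable {K : ℝ≥0 → ℝ≥0 → ℝ≥0 → ℝ≥0 → ℝ≥0∞} {X Y : Type*}

theorem IsConeKernel.exists_pos_le (hK : IsConeKernel K) {δ : ℝ≥0} (hδ : 0 < δ) :
    ∃ c : ℝ≥0∞, 0 < c ∧ ∀ t u a b, a + δ ≤ b → b ≤ 1 → c ≤ K t u a b := by
  have hlsc : LowerSemicontinuous fun v : ℝ≥0 × ℝ≥0 => K 0 0 v.1 v.2 :=
    hK.lsc.comp (g := fun v : ℝ≥0 × ℝ≥0 => (((0 : ℝ≥0), (0 : ℝ≥0)), v)) (by fun_prop)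
  let C : Set (ℝ≥0 × ℝ≥0) := {v | v.1 + δ ≤ v.2 ∧ v.2 ≤ 1}
  have hC : IsCompact C := by
    refine (isCompact_Icc (a := ((0 : ℝ≥0), (0 : ℝ≥0))) (b := (1, 1))).of_isClosed_subset
      ((isClosed_le (by fun_prop) (by fun_prop)).inter (isClosed_le (by fun_prop) (by fun_prop))) ?_
    rintro v ⟨hab, hb⟩
    exact ⟨⟨zero_le, zero_le⟩, (le_self_add.trans hab).trans hb, hb⟩
  rcases C.eq_empty_or_nonempty with hempty | hne
  · exact ⟨1, one_pos, fun t u a b hab hb => (eq_empty_iff_forall_notMem.1 hempty (a, b)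
      ⟨hab, hb⟩).elim⟩
  obtain ⟨v, hv, hmin⟩ := LowerSemicontinuousOn.exists_isMinOn hne hC (hlsc.lowerSemicontinuousOn _)
  refine ⟨K 0 0 v.1 v.2, pos_of_ne_zero fun h => ?_, fun t u a b hab hb =>
    (hmin (a := (a, b)) ⟨hab, hb⟩).trans (hK.base_le t u a b)⟩
  have heq : v.1 = v.2 := ((hK.eq_zero_iff _ _ _ _).1 h).1
  exact (lt_add_of_pos_right v.1 hδ).not_ge (hv.1.trans_eq heq.symm)

theorem lintegral_le_lintegral_min_add {S : Type*} [MeasurableSpace S] (β : Measure S)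
    {a b : S → ℝ≥0} (ha : Measurable a) (hb : Measurable b) (hle : ∀ᵐ s ∂β, a s ≤ 1) (δ : ℝ≥0) :
    ∫⁻ s, a s ∂β ≤ ∫⁻ s, (min (a s) (b s) : ℝ≥0) ∂β + δ * β univ + β {s | b s + δ ≤ a s} := by
  have hset : MeasurableSet {s | b s + δ ≤ a s} := measurableSet_le (by fun_prop) (by fun_prop)
  rw [← lintegral_const, ← lintegral_indicator_one hset, ← lintegral_add_left (by fun_prop),
    ← lintegral_add_right _ (measurable_one.indicator hset)]
  refine lintegral_mono_ae ?_
  filter_upwards [hle] with s hs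
  by_cases h : b s + δ ≤ a s
  · rw [indicator_of_mem (by exact h)]
    exact le_add_left (ENNReal.coe_le_one_iff.2 hs)
  · refine le_trans ?_ le_self_add
    rw [← ENNReal.coe_add, ENNReal.coe_le_coe, ← min_add_add_right]
    exact le_min le_self_add (not_le.1 h).le

section Plan

variable [MeasurableSpace X] [MeasurableSpace Y] {μ : Measure X} {ν : Measure Y}
  {β : Measure (WeightedPair X Y)}

theorem IsWeightedPlan.lintegral_left (hβ : IsWeightedPlan μ ν β) :
    ∫⁻ w, w.1.2 ∂β = μ univ := by
  rw [← hβ.left, ← lintegral_one, lintegral_reweight (by fun_prop) (by fun_prop) (by fun_prop)]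
  simp only [mul_one]

theorem IsWeightedPlan.lintegral_right (hβ : IsWeightedPlan μ ν β) :
    ∫⁻ w, w.2.2 ∂β = ν univ := by
  rw [← hβ.right, ← lintegral_one, lintegral_reweight (by fun_prop) (by fun_prop) (by fun_prop)]
  simp only [mul_one]

theorem IsWeightedPlan.lintegral_add (hβ : IsWeightedPlan μ ν β) :
    ∫⁻ w, (w.1.2 + w.2.2 : ℝ≥0) ∂β = μ univ + ν univ := by
  rw [← hβ.lintegral_left, ← hβ.lintegral_right, ← lintegral_add_left (by fun_prop)]
  simp only [ENNReal.coe_add]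

theorem IsWeightedPlan.measure_univ (hβ : IsWeightedPlan μ ν β)
    (hnorm : ∀ᵐ w ∂β, w.1.2 + w.2.2 = 1) : β univ = μ univ + ν univ := by
  rw [← hβ.lintegral_add, ← lintegral_one]
  refine lintegral_congr_ae ?_
  filter_upwards [hnorm] with w hw
  rw [hw, ENNReal.coe_one]

/-- The measure whose density with respect to a plan is the smaller of the two weights. Its
marginals are dominated by those of the plan. -/
def commonPart (β : Measure (WeightedPair X Y)) : Measure (WeightedPair X Y) :=
  β.withDensity fun w => (min w.1.2 w.2.2 : ℝ≥0)

theorem commonPart_le (hnorm : ∀ᵐ w ∂β, w.1.2 + w.2.2 = 1) : commonPart β ≤ β := by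
  conv_rhs => rw [← withDensity_one (μ := β)]
  refine withDensity_mono ?_
  filter_upwards [hnorm] with w hw
  exact ENNReal.coe_le_one_iff.2 ((min_le_left _ _).trans (le_self_add.trans_eq hw))

theorem IsWeightedPlan.map_commonPart_left_le (hβ : IsWeightedPlan μ ν β) :
    (commonPart β).map (fun w => w.1.1) ≤ μ := by
  rw [← hβ.left]
  exact Measure.map_mono (withDensity_mono (Eventually.of_forall fun _ =>
    ENNReal.coe_le_coe.2 (min_le_left _ _))) (by fun_prop)

theorem IsWeightedPlan.map_commonPart_right_le (hβ : IsWeightedPlan μ ν β) :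
    (commonPart β).map (fun w => w.2.1) ≤ ν := by
  rw [← hβ.right]
  exact Measure.map_mono (withDensity_mono (Eventually.of_forall fun _ =>
    ENNReal.coe_le_coe.2 (min_le_right _ _))) (by fun_prop)

theorem commonPart_univ (β : Measure (WeightedPair X Y)) :
    commonPart β univ = ∫⁻ w, (min w.1.2 w.2.2 : ℝ≥0) ∂β := by
  rw [commonPart, withDensity_apply _ MeasurableSet.univ, Measure.restrict_univ]

theorem commonPart_map_swap_univ (β : Measure (WeightedPair X Y)) :
    commonPart (β.map Prod.swap) univ = commonPart β univ := by
  rw [commonPart_univ, commonPart_univ, lintegral_map (by fun_prop) measurable_swap]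
  simp only [Prod.fst_swap, Prod.snd_swap, min_comm]

end Plan

variable [MetricSpace X] [MetricSpace Y]

theorem IsConeKernel.pairCost_self_eq_zero (hK : IsConeKernel K) {w : WeightedPair X Y}
    (h : pairCost K w w = 0) (hnorm : w.1.2 + w.2.2 = 1) : w.1.2 = 2⁻¹ ∧ w.2.2 = 2⁻¹ := by
  have heq : w.1.2 = w.2.2 :=
    (mul_self_inj zero_le zero_le).1 ((hK.eq_zero_iff _ _ _ _).1 h).1
  have hhalf : w.2.2 = 2⁻¹ := by
    rw [heq, ← two_mul] at hnorm
    exact eq_inv_of_mul_eq_one_right hnorm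
  exact ⟨heq.trans hhalf, hhalf⟩

theorem IsConeKernel.dist_eq_of_pairCost_eq_zero (hK : IsConeKernel K) {w z : WeightedPair X Y}
    (hw : pairCost K w w = 0) (hz : pairCost K z z = 0) (hwz : pairCost K w z = 0)
    (hw1 : w.1.2 + w.2.2 = 1) (hz1 : z.1.2 + z.2.2 = 1) :
    dist w.1.1 z.1.1 = dist w z ∧ dist w.2.1 z.2.1 = dist w z := by
  obtain ⟨hwa, hwb⟩ := hK.pairCost_self_eq_zero hw hw1
  obtain ⟨hza, hzb⟩ := hK.pairCost_self_eq_zero hz hz1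
  have hnndist : nndist w.1.1 z.1.1 = nndist w.2.1 z.2.1 :=
    ((hK.eq_zero_iff _ _ _ _).1 hwz).2.resolve_left (by simp [hwa, hza])
  have hdist : dist w.1.1 z.1.1 = dist w.2.1 z.2.1 := congrArg NNReal.toReal hnndist
  simp [Prod.dist_eq, hwa, hwb, hza, hzb, hdist]

variable [MeasurableSpace X] [MeasurableSpace Y]

theorem mul_measure_sq_le_energy {δ : ℝ≥0} {c : ℝ≥0∞}
    (hc : ∀ t u a b, a + δ * δ ≤ b → b ≤ 1 → c ≤ K t u a b) {β : Measure (WeightedPair X Y)}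
    (hle : ∀ᵐ w ∂β, w.2.2 ≤ 1) : c * β {w | w.1.2 + δ ≤ w.2.2} ^ 2 ≤ energy K β := by
  have hprod : ∀ {a b a' b' : ℝ≥0}, a + δ ≤ b → a' + δ ≤ b' → a * a' + δ * δ ≤ b * b' := by
    intro a b a' b' h h'
    calc a * a' + δ * δ ≤ a * a' + δ * δ + (a * δ + δ * a') := le_self_add
      _ = (a + δ) * (a' + δ) := by ring
      _ ≤ b * b' := mul_le_mul' h h'
  have hset : MeasurableSet {w : WeightedPair X Y | w.1.2 + δ ≤ w.2.2 ∧ w.2.2 ≤ 1} :=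
    (measurableSet_le (by fun_prop) (by fun_prop)).inter
      (measurableSet_le (by fun_prop) (by fun_prop))
  have hmeas : β {w | w.1.2 + δ ≤ w.2.2} ≤ β {w | w.1.2 + δ ≤ w.2.2 ∧ w.2.2 ≤ 1} := by
    refine measure_mono_ae ?_
    filter_upwards [hle] with w hw h using ⟨h, hw⟩
  refine le_trans ?_ (mul_measure_mul_measure_le_lintegral β hset hset (c := c) ?_)
  · rw [sq]
    gcongr
  · rintro w ⟨hw, hw1⟩ z ⟨hz, hz1⟩
    exact hc _ _ _ _ (hprod hw hz) (mul_le_one' hw1 hz1)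

theorem IsConeKernel.tendsto_measure_add_le (hK : IsConeKernel K) {ι : Type*} {F : Filter ι}
    {β : ι → Measure (WeightedPair X Y)} (hle : ∀ i, ∀ᵐ w ∂β i, w.2.2 ≤ 1)
    (henergy : Tendsto (fun i => energy K (β i)) F (𝓝 0)) {δ : ℝ≥0} (hδ : 0 < δ) :
    Tendsto (fun i => β i {w | w.1.2 + δ ≤ w.2.2}) F (𝓝 0) := by
  obtain ⟨c, hc, hcK⟩ := hK.exists_pos_le (mul_pos hδ hδ)
  refine ENNReal.tendsto_nhds_zero.2 fun ε hε => ?_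
  have hpos : 0 < c * ε ^ 2 := ENNReal.mul_pos hc.ne' (pow_ne_zero 2 hε.ne')
  filter_upwards [henergy.eventually_lt_const hpos] with i hi
  by_contra! hlt
  refine ((mul_measure_sq_le_energy hcK (hle i)).trans_lt hi).not_ge ?_
  gcongr

theorem IsConeKernel.measure_univ_right_le_of_tendsto_commonPart (hK : IsConeKernel K)
    {μ : Measure X} {ν : Measure Y} [IsFiniteMeasure μ] [IsFiniteMeasure ν] {ι : Type*}
    {F : Filter ι} [F.NeBot] {β : ι → Measure (WeightedPair X Y)}
    (hβ : ∀ i, IsWeightedPlan μ ν (β i)) (hnorm : ∀ i, ∀ᵐ w ∂β i, w.1.2 + w.2.2 = 1)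
    (henergy : Tendsto (fun i => energy K (β i)) F (𝓝 0)) {m : ℝ≥0∞}
    (hm : Tendsto (fun i => commonPart (β i) univ) F (𝓝 m)) : ν univ ≤ m := by
  have hδ : ∀ δ : ℝ≥0, 0 < δ → ν univ ≤ m + δ * (μ univ + ν univ) := by
    intro δ hδ
    have hle : ∀ i, ∀ᵐ w ∂β i, w.2.2 ≤ 1 := fun i => (hnorm i).mono fun w hw => hw ▸ le_add_self
    have hlim := (hm.add_const (δ * (μ univ + ν univ))).add
      (hK.tendsto_measure_add_le hle henergy hδ)
    rw [add_zero] at hlim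
    refine ge_of_tendsto' hlim fun i => ?_
    have hmin := lintegral_le_lintegral_min_add (β i) (a := fun w => w.2.2) (b := fun w => w.1.2)
      (by fun_prop) (by fun_prop) (hle i) δ
    simp only [min_comm _ (Prod.snd (Prod.fst _))] at hmin
    rwa [← commonPart_univ, (hβ i).lintegral_right, (hβ i).measure_univ (hnorm i)] at hmin
  have hlim : Tendsto (fun δ : ℝ≥0 => m + δ * (μ univ + ν univ)) (𝓝[>] 0) (𝓝 (m + 0)) := by
    refine tendsto_const_nhds.add (Tendsto.mono_left ?_ nhdsWithin_le_nhds)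
    have h0 : Tendsto (fun δ : ℝ≥0 => (δ : ℝ≥0∞)) (𝓝 0) (𝓝 0) := ENNReal.tendsto_coe.2 tendsto_id
    simpa only [zero_mul] using
      ENNReal.Tendsto.mul_const h0 (Or.inr (by finiteness : μ univ + ν univ ≠ ∞))
  rw [add_zero] at hlim
  exact ge_of_tendsto hlim (eventually_nhdsWithin_of_forall hδ)

variable [BorelSpace X] [BorelSpace Y] [SecondCountableTopology X] [SecondCountableTopology Y]

theorem IsConeKernel.measure_univ_left_le_of_tendsto_commonPart (hK : IsConeKernel K)
    {μ : Measure X} {ν : Measure Y} [IsFiniteMeasure μ] [IsFiniteMeasure ν] {ι : Type*}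
    {F : Filter ι} [F.NeBot] {β : ι → Measure (WeightedPair X Y)}
    (hβ : ∀ i, IsWeightedPlan μ ν (β i)) (hnorm : ∀ i, ∀ᵐ w ∂β i, w.1.2 + w.2.2 = 1)
    (henergy : Tendsto (fun i => energy K (β i)) F (𝓝 0)) {m : ℝ≥0∞}
    (hm : Tendsto (fun i => commonPart (β i) univ) F (𝓝 m)) : μ univ ≤ m := by
  have := fun i => (hβ i).finite
  refine hK.measure_univ_right_le_of_tendsto_commonPart (fun i => (hβ i).swap) (F := F)
    (fun i => ?_) ?_ ?_
  · rw [ae_map_iff measurable_swap.aemeasurable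
      (measurableSet_eq_fun (by fun_prop) (by fun_prop))]
    exact (hnorm i).mono fun w hw => (add_comm _ _).trans hw
  · simpa only [hK.energy_map_swap] using henergy
  · simpa only [commonPart_map_swap_univ] using hm

theorem IsConeKernel.exists_normalized (hK : IsConeKernel K) {μ : Measure X} {ν : Measure Y}
    [IsFiniteMeasure μ] [IsFiniteMeasure ν] {α : Measure (WeightedPair X Y)}
    (hα : IsWeightedPlan μ ν α) :
    ∃ β, IsWeightedPlan μ ν β ∧ energy K β = energy K α ∧ ∀ᵐ w ∂β, w.1.2 + w.2.2 = 1 := by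
  have hω : Measurable fun w : WeightedPair X Y => w.1.2 + w.2.2 := by fun_prop
  have hF : Measurable fun w : WeightedPair X Y => w.scale (w.1.2 + w.2.2)⁻¹ := by
    unfold WeightedPair.scale
    fun_prop
  have hscale : ∀ w : WeightedPair X Y,
      ((w.scale (w.1.2 + w.2.2)⁻¹).scale (w.1.2 + w.2.2)).toCone = w.toCone := by
    intro w
    by_cases hw : w.1.2 + w.2.2 = 0
    · obtain ⟨hw1, hw2⟩ := add_eq_zero.1 hw
      simp [WeightedPair.toCone, WeightedPair.scale, hw1, hw2]
    · simp only [WeightedPair.toCone, WeightedPair.scale, mul_inv_cancel_left₀ hw]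
  have := hα.finite
  refine ⟨_, hα.reweight hω hF hscale (by rw [hα.lintegral_add]; finiteness),
    hK.energy_reweight α hω hF hscale, ?_⟩
  rw [reweight, ae_map_iff hF.aemeasurable (measurableSet_eq_fun (by fun_prop) (by fun_prop)),
    ae_withDensity_iff (by fun_prop)]
  refine Eventually.of_forall fun w hw => ?_
  simp only [WeightedPair.scale]
  rw [← mul_add, inv_mul_cancel₀ (by simpa using hw)]

theorem IsConeKernel.exists_seq_tendsto_energy_zero (hK : IsConeKernel K) {μ : Measure X}
    {ν : Measure Y} [IsFiniteMeasure μ] [IsFiniteMeasure ν] (h : divergence K μ ν = 0) :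
    ∃ β : ℕ → Measure (WeightedPair X Y), (∀ n, IsWeightedPlan μ ν (β n)) ∧
      (∀ n, ∀ᵐ w ∂β n, w.1.2 + w.2.2 = 1) ∧ Tendsto (fun n => energy K (β n)) atTop (𝓝 0) := by
  have hseq : ∀ n : ℕ, ∃ β : Measure (WeightedPair X Y), IsWeightedPlan μ ν β ∧
      energy K β ≤ (n : ℝ≥0∞)⁻¹ ∧ ∀ᵐ w ∂β, w.1.2 + w.2.2 = 1 := by
    intro n
    have hlt : divergence K μ ν < (n : ℝ≥0∞)⁻¹ := h ▸ by simp
    obtain ⟨α, hα, hαn⟩ := by simpa only [divergence, iInf_lt_iff, exists_prop] using hlt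
    obtain ⟨β, hβ, henergy, hnorm⟩ := hK.exists_normalized hα
    exact ⟨β, hβ, henergy ▸ hαn.le, hnorm⟩
  choose β hβ henergy hnorm using hseq
  exact ⟨β, hβ, hnorm, tendsto_of_tendsto_of_tendsto_of_le_of_le tendsto_const_nhds
    ENNReal.tendsto_inv_nat_nhds_zero (fun _ => zero_le) henergy⟩

variable [CompleteSpace X] [CompleteSpace Y] {μ : Measure X} {ν : Measure Y} [IsFiniteMeasure μ]
  [IsFiniteMeasure ν]

theorem isTightMeasureSet_range_commonPart {ι : Type*} {β : ι → Measure (WeightedPair X Y)}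
    (hβ : ∀ i, IsWeightedPlan μ ν (β i)) (hnorm : ∀ i, ∀ᵐ w ∂β i, w.1.2 + w.2.2 = 1) :
    IsTightMeasureSet (range fun i => commonPart (β i)) := by
  have hnorm' : ∀ i, ∀ᵐ w ∂commonPart (β i), w.1.2 + w.2.2 = 1 := fun i =>
    (withDensity_absolutelyContinuous _ _).ae_le (hnorm i)
  refine .prodMk (isTightMeasureSet_prod_of_forall_le (isTightMeasureSet_singleton (μ := μ)) ?_
    isCompact_Icc (measurableSet_Icc (a := 0) (b := 1)) ?_)
    (isTightMeasureSet_prod_of_forall_le (isTightMeasureSet_singleton (μ := ν)) ?_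
      isCompact_Icc (measurableSet_Icc (a := 0) (b := 1)) ?_) <;>
    rintro _ ⟨_, ⟨i, rfl⟩, rfl⟩
  · rw [Measure.fst, Measure.fst, Measure.map_map measurable_fst measurable_fst]
    exact (hβ i).map_commonPart_left_le
  · refine (ae_map_iff measurable_fst.aemeasurable (measurable_snd measurableSet_Icc)).2 ?_
    filter_upwards [hnorm' i] with w hw using ⟨zero_le, hw ▸ le_self_add⟩
  · rw [Measure.fst, Measure.snd, Measure.map_map measurable_fst measurable_snd]
    exact (hβ i).map_commonPart_right_le
  · refine (ae_map_iff measurable_snd.aemeasurable (measurable_snd measurableSet_Icc)).2 ?_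
    filter_upwards [hnorm' i] with w hw using ⟨zero_le, hw ▸ le_add_self⟩

theorem exists_tendsto_commonPart {ι : Type*} {β : ι → Measure (WeightedPair X Y)}
    (hβ : ∀ i, IsWeightedPlan μ ν (β i)) (hnorm : ∀ i, ∀ᵐ w ∂β i, w.1.2 + w.2.2 = 1)
    (F : Ultrafilter ι) :
    ∃ (r : ι → FiniteMeasure (WeightedPair X Y)) (ρ : FiniteMeasure (WeightedPair X Y)),
      (∀ i, (r i : Measure (WeightedPair X Y)) = commonPart (β i)) ∧ Tendsto r F (𝓝 ρ) := by
  have hfin : ∀ i, IsFiniteMeasure (commonPart (β i)) := fun i =>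
    have := (hβ i).finite
    isFiniteMeasure_of_le _ (commonPart_le (hnorm i))
  let r : ι → FiniteMeasure (WeightedPair X Y) := fun i => ⟨commonPart (β i), hfin i⟩
  have hmass : ∀ i, (r i).mass ≤ (μ univ + ν univ).toNNReal := fun i => by
    rw [← ENNReal.coe_le_coe, ENNReal.coe_toNNReal (by finiteness), FiniteMeasure.ennreal_mass,
      ← (hβ i).measure_univ (hnorm i)]
    exact commonPart_le (hnorm i) univ
  obtain ⟨ρ, hρ⟩ := exists_tendsto_of_isTightMeasureSet hmass
    (isTightMeasureSet_range_commonPart hβ hnorm) F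
  exact ⟨r, ρ, fun _ => rfl, hρ⟩

theorem IsConeKernel.exists_coupling_of_divergence_eq_zero (hK : IsConeKernel K)
    (h : divergence K μ ν = 0) :
    ∃ γ : Measure (WeightedPair X Y), γ.map (fun w => w.1.1) = μ ∧ γ.map (fun w => w.2.1) = ν ∧
      ∀ w ∈ γ.support, ∀ z ∈ γ.support,
        dist w.1.1 z.1.1 = dist w z ∧ dist w.2.1 z.2.1 = dist w z := by
  obtain ⟨β, hβ, hnorm, henergy⟩ := hK.exists_seq_tendsto_energy_zero h
  let F : Ultrafilter ℕ := hyperfilter ℕ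
  replace henergy : Tendsto (fun n => energy K (β n)) F (𝓝 0) :=
    henergy.mono_left Nat.hyperfilter_le_atTop
  obtain ⟨r, ρ, hr, hρ⟩ := exists_tendsto_commonPart hβ hnorm F
  have hmass : Tendsto (fun n => commonPart (β n) univ) F
      (𝓝 ((ρ : Measure (WeightedPair X Y)) univ)) := by
    simpa only [FiniteMeasure.ennreal_mass, hr] using ENNReal.tendsto_coe.2 hρ.mass
  have hleft : (ρ : Measure (WeightedPair X Y)).map (fun w => w.1.1) = μ :=
    map_eq_of_tendsto hρ (by fun_prop) (fun n => by rw [hr n]; exact (hβ n).map_commonPart_left_le)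
      (hK.measure_univ_left_le_of_tendsto_commonPart hβ hnorm henergy hmass)
  have hright : (ρ : Measure (WeightedPair X Y)).map (fun w => w.2.1) = ν :=
    map_eq_of_tendsto hρ (by fun_prop) (fun n => by rw [hr n]; exact (hβ n).map_commonPart_right_le)
      (hK.measure_univ_right_le_of_tendsto_commonPart hβ hnorm henergy hmass)
  have hzero : ∀ w ∈ (ρ : Measure (WeightedPair X Y)).support,
      ∀ z ∈ (ρ : Measure (WeightedPair X Y)).support, pairCost K w z = 0 := by
    refine fun w hw z hz =>
      eq_zero_of_tendsto_lintegral_lintegral hρ hK.lowerSemicontinuous_pairCost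
      (tendsto_of_tendsto_of_tendsto_of_le_of_le tendsto_const_nhds henergy (fun _ => zero_le)
        fun n => ?_) hw hz
    have hle : (r n : Measure (WeightedPair X Y)) ≤ β n := (hr n).trans_le (commonPart_le (hnorm n))
    exact lintegral_mono' hle fun w => lintegral_mono' hle le_rfl
  have hone : (ρ : Measure (WeightedPair X Y)).support ⊆ {w | w.1.2 + w.2.2 = 1} := by
    refine support_subset_of_tendsto hρ (isClosed_eq (by fun_prop) (by fun_prop)) fun n => ?_
    rw [hr n]
    exact (withDensity_absolutelyContinuous _ _).ae_le (hnorm n)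
  exact ⟨ρ, hleft, hright, fun w hw z hz => hK.dist_eq_of_pairCost_eq_zero (hzero w hw w hw)
    (hzero z hz z hz) (hzero w hw z hz) (hone hw) (hone hz)⟩

theorem IsConeKernel.exists_isometryEquiv_of_divergence_eq_zero (hK : IsConeKernel K)
    (h : divergence K μ ν = 0) :
    ∃ e : μ.support ≃ᵢ ν.support,
      (μ.comap (Subtype.val : μ.support → X)).map e = ν.comap (Subtype.val : ν.support → Y) := by
  obtain ⟨γ, rfl, rfl, hdist⟩ := hK.exists_coupling_of_divergence_eq_zero h
  obtain ⟨e, he⟩ := exists_isometryEquiv_support_map (f := fun w : WeightedPair X Y => w.1.1)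
    (by fun_prop) γ fun w hw z hz => (hdist w hw z hz).1
  obtain ⟨e', he'⟩ := exists_isometryEquiv_support_map (f := fun w : WeightedPair X Y => w.2.1)
    (by fun_prop) γ fun w hw z hz => (hdist w hw z hz).2
  refine ⟨e.symm.trans e', ?_⟩
  rw [← he, ← he', Measure.map_map (e.symm.trans e').continuous.measurable e.continuous.measurable]
  congr 1
  ext v
  simp

end Vanishing

/-! ### Explicit plans -/

section ExplicitPlans

variable {K : ℝ≥0 → ℝ≥0 → ℝ≥0 → ℝ≥0 → ℝ≥0∞} {X Y : Type*} [MeasurableSpace X]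
  [MeasurableSpace Y] {μ : Measure X} {ν : Measure Y}

theorem isWeightedPlan_map_one {S : Type*} [MeasurableSpace S] {f : S → X} {g : S → Y}
    (hf : Measurable f) (hg : Measurable g) (Γ : Measure S) [IsFiniteMeasure Γ] :
    IsWeightedPlan (Γ.map f) (Γ.map g) (Γ.map fun s => ((f s, 1), (g s, 1))) where
  finite := inferInstance
  left := by
    rw [reweight_map (by fun_prop) (by fun_prop) (by fun_prop), reweight_one]
  right := by
    rw [reweight_map (by fun_prop) (by fun_prop) (by fun_prop), reweight_one]

/-- The plan that transports nothing: all of `μ` is sent to the apex over `y₀`, and all of `ν`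
comes from the apex over `x₀`. -/
def splitPlan (μ : Measure X) (ν : Measure Y) (x₀ : X) (y₀ : Y) : Measure (WeightedPair X Y) :=
  μ.map (fun x => ((x, 1), (y₀, 0))) + ν.map fun y => ((x₀, 0), (y, 1))

theorem isWeightedPlan_splitPlan (μ : Measure X) (ν : Measure Y) [IsFiniteMeasure μ]
    [IsFiniteMeasure ν] (x₀ : X) (y₀ : Y) : IsWeightedPlan μ ν (splitPlan μ ν x₀ y₀) where
  finite := by unfold splitPlan; infer_instance
  left := by
    rw [splitPlan, reweight_add _ (by fun_prop), reweight_map (by fun_prop) (by fun_prop)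
      (by fun_prop), reweight_map (by fun_prop) (by fun_prop) (by fun_prop), reweight_one,
      reweight_eq_zero (by fun_prop) _ (ae_of_all _ fun _ => rfl), Measure.map_id', add_zero]
  right := by
    rw [splitPlan, reweight_add _ (by fun_prop), reweight_map (by fun_prop) (by fun_prop)
      (by fun_prop), reweight_map (by fun_prop) (by fun_prop) (by fun_prop), reweight_one,
      reweight_eq_zero (by fun_prop) _ (ae_of_all _ fun _ => rfl), Measure.map_id', zero_add]

theorem ae_splitPlan (μ : Measure X) (ν : Measure Y) (x₀ : X) (y₀ : Y) :
    ∀ᵐ w ∂splitPlan μ ν x₀ y₀, (w.1.2 = 1 ∧ w.2.2 = 0) ∨ (w.1.2 = 0 ∧ w.2.2 = 1) := by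
  have hmeas : MeasurableSet {w : WeightedPair X Y |
      (w.1.2 = 1 ∧ w.2.2 = 0) ∨ (w.1.2 = 0 ∧ w.2.2 = 1)} := by measurability
  rw [splitPlan, ae_add_measure_iff, ae_map_iff (by fun_prop) hmeas, ae_map_iff (by fun_prop) hmeas]
  simp

variable [MetricSpace X] [MetricSpace Y]

theorem IsConeKernel.energy_splitPlan_ne_top (hK : IsConeKernel K) (hleft : K 0 0 1 0 ≠ ∞)
    (hright : K 0 0 0 1 ≠ ∞) [IsFiniteMeasure μ] [IsFiniteMeasure ν] (x₀ : X) (y₀ : Y) :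
    energy K (splitPlan μ ν x₀ y₀) ≠ ∞ := by
  have := (isWeightedPlan_splitPlan μ ν x₀ y₀).finite
  have hae := ae_splitPlan μ ν x₀ y₀
  have hzero : ∀ t u, K t u 0 0 = 0 := fun t u => (hK.eq_zero_iff _ _ _ _).2 (by simp)
  have hle : energy K (splitPlan μ ν x₀ y₀) ≤
      ∫⁻ _, ∫⁻ _, (K 0 0 1 0 + K 0 0 0 1) ∂splitPlan μ ν x₀ y₀ ∂splitPlan μ ν x₀ y₀ := by
    refine lintegral_mono_ae ?_
    filter_upwards [hae] with w hw
    refine lintegral_mono_ae ?_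
    filter_upwards [hae] with z hz
    rcases hw with ⟨ha, hb⟩ | ⟨ha, hb⟩ <;> rcases hz with ⟨ha', hb'⟩ | ⟨ha', hb'⟩ <;>
      simp only [pairCost, ha, hb, ha', hb', mul_zero, mul_one, hzero, zero_le]
    · exact (hK.apex _ _ 0 0 1 0 (by simp)).trans_le le_self_add
    · exact (hK.apex _ _ 0 0 0 1 (by simp)).trans_le le_add_self
  refine ne_top_of_le_ne_top ?_ hle
  rw [lintegral_const, lintegral_const]
  finiteness

theorem IsConeKernel.divergence_ne_top (hK : IsConeKernel K) (hleft : K 0 0 1 0 ≠ ∞)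
    (hright : K 0 0 0 1 ≠ ∞) [Nonempty X] [Nonempty Y] (μ : Measure X) (ν : Measure Y)
    [IsFiniteMeasure μ] [IsFiniteMeasure ν] : divergence K μ ν ≠ ∞ :=
  let ⟨x₀⟩ := ‹Nonempty X›
  let ⟨y₀⟩ := ‹Nonempty Y›
  ne_top_of_le_ne_top (hK.energy_splitPlan_ne_top hleft hright x₀ y₀)
    (iInf₂_le _ (isWeightedPlan_splitPlan μ ν x₀ y₀))

variable [BorelSpace X] [BorelSpace Y] [SecondCountableTopology X] [SecondCountableTopology Y]

theorem IsConeKernel.divergence_map_map (hK : IsConeKernel K) {S : Type*} [MeasurableSpace S]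
    {f : S → X} {g : S → Y} (hf : Measurable f) (hg : Measurable g)
    (hfg : ∀ s t, nndist (f s) (f t) = nndist (g s) (g t)) (Γ : Measure S) [IsFiniteMeasure Γ] :
    divergence K (Γ.map f) (Γ.map g) = 0 := by
  refine le_antisymm ((iInf₂_le _ (isWeightedPlan_map_one hf hg Γ)).trans_eq ?_) zero_le
  rw [hK.energy_map Γ (by fun_prop)]
  have hzero : ∀ s t, pairCost K ((f s, 1), (g s, 1)) ((f t, 1), (g t, 1)) = 0 := fun s t =>
    (hK.eq_zero_iff _ _ _ _).2 ⟨rfl, Or.inr (hfg s t)⟩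
  simp only [hzero, lintegral_zero]

theorem IsConeKernel.divergence_eq_zero_of_isometryEquiv (hK : IsConeKernel K)
    [IsFiniteMeasure μ] (e : μ.support ≃ᵢ ν.support)
    (he : (μ.comap (Subtype.val : μ.support → X)).map e =
      ν.comap (Subtype.val : ν.support → Y)) : divergence K μ ν = 0 := by
  have hmeas : Measurable e := e.continuous.measurable
  have hμ := map_val_comap_val_support μ
  have hν : (μ.comap (Subtype.val : μ.support → X)).map (Subtype.val ∘ e) = ν := by
    rw [← Measure.map_map measurable_subtype_coe hmeas, he, map_val_comap_val_support]
  have : IsFiniteMeasure (μ.comap (Subtype.val : μ.support → X)) := by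
    rw [← Measure.isFiniteMeasure_map_iff measurable_subtype_coe.aemeasurable, hμ]
    infer_instance
  have hzero := hK.divergence_map_map measurable_subtype_coe
    (measurable_subtype_coe.comp hmeas) (fun x x' => (e.isometry.nndist_eq x x').symm)
    (μ.comap (Subtype.val : μ.support → X))
  rwa [hμ, hν] at hzero

theorem IsConeKernel.divergence_eq_zero_iff (hK : IsConeKernel K) [CompleteSpace X]
    [CompleteSpace Y] [IsFiniteMeasure μ] [IsFiniteMeasure ν] :
    divergence K μ ν = 0 ↔ ∃ e : μ.support ≃ᵢ ν.support,
      (μ.comap (Subtype.val : μ.support → X)).map e = ν.comap (Subtype.val : ν.support → Y) :=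
  ⟨hK.exists_isometryEquiv_of_divergence_eq_zero,
    fun ⟨e, he⟩ => hK.divergence_eq_zero_of_isometryEquiv e he⟩

end ExplicitPlans

/-! ### The triangle inequality -/

section Triangle

open ProbabilityTheory in
theorem exists_glue {A B C : Type*} [MeasurableSpace A] [MeasurableSpace B] [MeasurableSpace C]
    [StandardBorelSpace A] [StandardBorelSpace C] [Nonempty A] [Nonempty C] (α : Measure (A × B))
    (β : Measure (B × C)) [IsFiniteMeasure α] [IsFiniteMeasure β] (h : α.snd = β.fst) :
    ∃ Γ : Measure (B × (A × C)), IsFiniteMeasure Γ ∧ Γ.map (fun t => (t.2.1, t.1)) = α ∧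
      Γ.map (fun t => (t.1, t.2.2)) = β := by
  let α' : Measure (B × A) := α.map Prod.swap
  have hα' : α'.fst = β.fst := Measure.fst_map_swap.trans h
  -- Under `Γ` the two outer coordinates are conditionally independent given the middle one.
  let κ : Kernel B (A × C) := α'.condKernel ×ₖ β.condKernel
  have hleft : (β.fst ⊗ₘ κ).map (Prod.map id Prod.fst) = α' := by
    rw [← Measure.compProd_map measurable_fst, ← Kernel.fst_eq, Kernel.fst_prod, ← hα',
      Measure.disintegrate]
  have hright : (β.fst ⊗ₘ κ).map (Prod.map id Prod.snd) = β := by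
    rw [← Measure.compProd_map measurable_snd, ← Kernel.snd_eq, Kernel.snd_prod,
      Measure.disintegrate]
  have hswap : α'.map Prod.swap = α := by
    rw [Measure.map_map measurable_swap measurable_swap, Prod.swap_swap_eq, Measure.map_id]
  refine ⟨β.fst ⊗ₘ κ, inferInstance, ?_, hright⟩
  rw [← hswap, ← hleft, Measure.map_map measurable_swap (measurable_id.prodMap measurable_fst)]
  rfl

theorem lintegral_rpow_one_div_le_add {S : Type*} [MeasurableSpace S] {Γ : Measure S} {q : ℝ}
    (hq : 1 ≤ q) {f g h : S → ℝ≥0∞} (hf : Measurable f) (hg : Measurable g)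
    (hfgh : ∀ s, h s ^ (1 / q) ≤ f s ^ (1 / q) + g s ^ (1 / q)) :
    (∫⁻ s, h s ∂Γ) ^ (1 / q) ≤ (∫⁻ s, f s ∂Γ) ^ (1 / q) + (∫⁻ s, g s ∂Γ) ^ (1 / q) := by
  have hq0 : 0 < q := zero_lt_one.trans_le hq
  have hpow : ∀ x : ℝ≥0∞, (x ^ (1 / q)) ^ q = x := fun x => by
    rw [one_div, ENNReal.rpow_inv_rpow hq0.ne']
  have hmink := ENNReal.lintegral_Lp_add_le (μ := Γ) (hf.pow_const (1 / q)).aemeasurable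
    (hg.pow_const (1 / q)).aemeasurable hq
  simp only [hpow] at hmink
  refine (ENNReal.rpow_le_rpow (lintegral_mono fun s => ?_) (by positivity)).trans hmink
  exact (hpow (h s)).symm.trans_le (ENNReal.rpow_le_rpow (hfgh s) hq0.le)

variable {X Y Z : Type*}

/-- The factor by which both weights have to be divided for the right weight to become `1`, or `1`
if the right weight vanishes. -/
def rightWeight (w : WeightedPair X Y) : ℝ≥0 :=
  if w.2.2 = 0 then 1 else w.2.2

/-- Division of both weights by `rightWeight`. The right base point is irrelevant when the right
weight vanishes, and is then replaced by `y₀`. -/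
def rightNormalize (y₀ : Y) (w : WeightedPair X Y) : WeightedPair X Y :=
  if w.2.2 = 0 then (w.1, (y₀, 0)) else ((w.1.1, w.1.2 / w.2.2), (w.2.1, 1))

theorem toCone_scale_rightNormalize (y₀ : Y) (w : WeightedPair X Y) :
    ((rightNormalize y₀ w).scale (rightWeight w)).toCone = w.toCone := by
  by_cases h : w.2.2 = 0
  · simp [rightNormalize, rightWeight, WeightedPair.scale, WeightedPair.toCone, h,
      Cone.mk_eq_mk]
  · simp [rightNormalize, rightWeight, WeightedPair.scale, WeightedPair.toCone, h,
      mul_div_cancel₀]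

variable {K : ℝ≥0 → ℝ≥0 → ℝ≥0 → ℝ≥0 → ℝ≥0∞} [MeasurableSpace X] [MeasurableSpace Y]
  [MeasurableSpace Z] {μ : Measure X} {ν : Measure Y} {ρ : Measure Z}
  {α β : Measure (WeightedPair X Y)}

theorem IsWeightedPlan.add_of_ae_eq_zero (hα : IsWeightedPlan μ ν α) [IsFiniteMeasure β]
    (hβ : ∀ᵐ w ∂β, w.1.2 = 0 ∧ w.2.2 = 0) : IsWeightedPlan μ ν (α + β) where
  finite := have := hα.finite; inferInstance
  left := by
    rw [reweight_add _ (by fun_prop), hα.left,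
      reweight_eq_zero (by fun_prop) _ (hβ.mono fun _ h => h.1), add_zero]
  right := by
    rw [reweight_add _ (by fun_prop), hα.right,
      reweight_eq_zero (by fun_prop) _ (hβ.mono fun _ h => h.2), add_zero]

theorem measurableSet_right_eq_zero : MeasurableSet {w : WeightedPair X Y | w.2.2 = 0} :=
  measurableSet_eq_fun (by fun_prop) (by fun_prop)

theorem measurable_rightWeight : Measurable (rightWeight : WeightedPair X Y → ℝ≥0) :=
  Measurable.ite measurableSet_right_eq_zero (by fun_prop) (by fun_prop)

theorem measurable_rightNormalize (y₀ : Y) :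
    Measurable (rightNormalize y₀ : WeightedPair X Y → WeightedPair X Y) :=
  Measurable.ite measurableSet_right_eq_zero (by fun_prop) (by fun_prop)

theorem IsWeightedPlan.lintegral_rightWeight_ne_top [IsFiniteMeasure ν]
    (hα : IsWeightedPlan μ ν α) : ∫⁻ w, rightWeight w ∂α ≠ ∞ := by
  have := hα.finite
  have hle : ∫⁻ w, rightWeight w ∂α ≤ ∫⁻ w, (1 + w.2.2 : ℝ≥0∞) ∂α := by
    refine lintegral_mono fun w => ?_
    rw [rightWeight]
    split_ifs
    · simp
    · exact le_add_self
  refine ne_top_of_le_ne_top ?_ hle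
  rw [lintegral_add_left measurable_const, hα.lintegral_right, lintegral_one]
  finiteness

theorem IsWeightedPlan.snd_reweight_rightNormalize (hα : IsWeightedPlan μ ν α) (y₀ : Y) :
    (ConicGW.reweight rightWeight (rightNormalize y₀) α).snd =
      ν.map (fun y => (y, (1 : ℝ≥0))) + α {w | w.2.2 = 0} • Measure.dirac (y₀, 0) := by
  refine Measure.ext_of_lintegral _ fun f hf => ?_
  rw [Measure.snd, lintegral_map hf measurable_snd,
    lintegral_reweight measurable_rightWeight (measurable_rightNormalize y₀) (by fun_prop),
    lintegral_add_measure, lintegral_map hf (by fun_prop), lintegral_smul_measure,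
    lintegral_dirac' _ hf, ← hα.right, lintegral_reweight (by fun_prop) (by fun_prop)
    (by fun_prop), smul_eq_mul, mul_comm (α _),
    ← lintegral_indicator_const measurableSet_right_eq_zero, ← lintegral_add_left (by fun_prop)]
  refine lintegral_congr fun w => ?_
  by_cases h : w.2.2 = 0 <;> simp [rightWeight, rightNormalize, h]

variable [MetricSpace X] [MetricSpace Y] [MetricSpace Z]

theorem divergence_rpow {r : ℝ} (hr : 0 < r) (μ : Measure X) (ν : Measure Y) :
    divergence K μ ν ^ r =
      ⨅ (α : Measure (WeightedPair X Y)) (_ : IsWeightedPlan μ ν α), energy K α ^ r :=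
  (ENNReal.orderIsoRpow r hr).map_iInf₂ _

theorem IsConeKernel.energy_add_of_ae_eq_zero (hK : IsConeKernel K)
    (hβ : ∀ᵐ w ∂β, w.1.2 = 0 ∧ w.2.2 = 0) : energy K (α + β) = energy K α := by
  have hinner : ∀ w, ∫⁻ z, pairCost K w z ∂β = 0 := fun w =>
    lintegral_eq_zero_of_ae_eq_zero <| hβ.mono fun z hz =>
      (hK.eq_zero_iff _ _ _ _).2 (by simp [hz])
  have houter : ∫⁻ w, ∫⁻ z, pairCost K w z ∂α ∂β = 0 :=
    lintegral_eq_zero_of_ae_eq_zero <| hβ.mono fun w hw => by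
      have hzero : ∀ z, pairCost K w z = 0 := fun z => (hK.eq_zero_iff _ _ _ _).2 (by simp [hw])
      simp [hzero]
  simp only [energy, lintegral_add_measure, hinner, houter, add_zero]

variable [BorelSpace X] [BorelSpace Y] [BorelSpace Z] [SecondCountableTopology X]
  [SecondCountableTopology Y] [SecondCountableTopology Z]

theorem IsConeKernel.eventually_exists_snd_eq (hK : IsConeKernel K) [Nonempty X]
    [IsFiniteMeasure ν] (hα : IsWeightedPlan μ ν α) (y₀ : Y) :
    ∀ᶠ M : ℝ≥0 in atTop, ∃ β, IsWeightedPlan μ ν β ∧ energy K β = energy K α ∧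
      β.snd = ν.map (fun y => (y, (1 : ℝ≥0))) + M • Measure.dirac (y₀, 0) := by
  have := hα.finite
  obtain ⟨x₀⟩ := ‹Nonempty X›
  let α' : Measure (WeightedPair X Y) := reweight rightWeight (rightNormalize y₀) α
  let m : ℝ≥0 := (α {w | w.2.2 = 0}).toNNReal
  have hα' : IsWeightedPlan μ ν α' := hα.reweight measurable_rightWeight
    (measurable_rightNormalize y₀) (toCone_scale_rightNormalize y₀) hα.lintegral_rightWeight_ne_top
  have hsnd : α'.snd = ν.map (fun y => (y, (1 : ℝ≥0))) + m • Measure.dirac (y₀, 0) := by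
    rw [hα.snd_reweight_rightNormalize, ← ENNReal.coe_toNNReal (measure_ne_top α _)]
    rfl
  have := hα'.finite
  filter_upwards [eventually_ge_atTop m] with M hM
  have hzero : ∀ᵐ w ∂(M - m) • Measure.dirac (((x₀, 0), (y₀, 0)) : WeightedPair X Y),
      w.1.2 = 0 ∧ w.2.2 = 0 :=
    Measure.ae_smul_measure ((ae_dirac_iff (by measurability)).2 ⟨rfl, rfl⟩) _
  refine ⟨_, hα'.add_of_ae_eq_zero hzero, ?_, ?_⟩
  · rw [hK.energy_add_of_ae_eq_zero hzero, hK.energy_reweight α measurable_rightWeight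
      (measurable_rightNormalize y₀) (toCone_scale_rightNormalize y₀)]
  · rw [Measure.snd_add, hsnd, Measure.snd, Measure.map_smul, Measure.map_dirac' measurable_snd,
      add_assoc, ← add_smul, add_tsub_cancel_of_le hM]

theorem IsConeKernel.measurable_pairCost_map (hK : IsConeKernel K) {S : Type*}
    [MeasurableSpace S] {F : S → WeightedPair X Y} (hF : Measurable F) :
    Measurable fun v : S × S => pairCost K (F v.1) (F v.2) :=
  hK.measurable_pairCost.comp (hF.prodMap hF)

theorem IsConeKernel.energy_map_eq_lintegral_prod (hK : IsConeKernel K) {S : Type*}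
    [MeasurableSpace S] (Γ : Measure S) [SFinite Γ] {F : S → WeightedPair X Y}
    (hF : Measurable F) :
    energy K (Γ.map F) = ∫⁻ v, pairCost K (F v.1) (F v.2) ∂(Γ.prod Γ) := by
  rw [hK.energy_map Γ hF, lintegral_prod _ (hK.measurable_pairCost_map hF).aemeasurable]

theorem IsConeKernel.energy_map_rpow_triangle (hK : IsConeKernel K) {q : ℝ} (hq : 1 ≤ q)
    (htri : ∀ t u v a b e : ℝ≥0,
      K t v a e ^ (1 / q) ≤ K t u a b ^ (1 / q) + K u v b e ^ (1 / q))
    {S : Type*} [MeasurableSpace S] (Γ : Measure S) [SFinite Γ] {f : S → X × ℝ≥0}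
    {g : S → Y × ℝ≥0} {h : S → Z × ℝ≥0} (hf : Measurable f) (hg : Measurable g)
    (hh : Measurable h) :
    energy K (Γ.map fun s => (f s, h s)) ^ (1 / q) ≤
      energy K (Γ.map fun s => (f s, g s)) ^ (1 / q) +
        energy K (Γ.map fun s => (g s, h s)) ^ (1 / q) := by
  rw [hK.energy_map_eq_lintegral_prod Γ (hf.prodMk hh),
    hK.energy_map_eq_lintegral_prod Γ (hf.prodMk hg),
    hK.energy_map_eq_lintegral_prod Γ (hg.prodMk hh)]
  exact lintegral_rpow_one_div_le_add hq (hK.measurable_pairCost_map (hf.prodMk hg))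
    (hK.measurable_pairCost_map (hg.prodMk hh)) fun _ => htri _ _ _ _ _ _

variable [CompleteSpace X] [CompleteSpace Z] [Nonempty X] [Nonempty Y] [Nonempty Z]

theorem IsConeKernel.exists_comp (hK : IsConeKernel K) {q : ℝ} (hq : 1 ≤ q)
    (htri : ∀ t u v a b e : ℝ≥0,
      K t v a e ^ (1 / q) ≤ K t u a b ^ (1 / q) + K u v b e ^ (1 / q))
    [IsFiniteMeasure ν] (hα : IsWeightedPlan μ ν α) {β : Measure (WeightedPair Y Z)}
    (hβ : IsWeightedPlan ν ρ β) :
    ∃ γ, IsWeightedPlan μ ρ γ ∧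
      energy K γ ^ (1 / q) ≤ energy K α ^ (1 / q) + energy K β ^ (1 / q) := by
  obtain ⟨y₀⟩ := ‹Nonempty Y›
  have := hβ.finite
  obtain ⟨M, ⟨α', hα', hEα, hsnd⟩, β', hβ', hEβ, hfst⟩ :=
    ((hK.eventually_exists_snd_eq hα y₀).and (hK.eventually_exists_snd_eq hβ.swap y₀)).exists
  have := hα'.finite
  have := hβ'.finite
  obtain ⟨Γ, hΓ, hleft, hright⟩ := exists_glue α' (β'.map Prod.swap) (by
    rw [Measure.fst_map_swap, hsnd, hfst])
  refine ⟨Γ.map Prod.snd, ⟨inferInstance, ?_, ?_⟩, ?_⟩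
  · rw [← hα'.left, ← hleft, reweight_map (by fun_prop) (by fun_prop) (by fun_prop),
      reweight_map (by fun_prop) (by fun_prop) (by fun_prop)]
  · rw [← hβ'.swap.right, ← hright, reweight_map (by fun_prop) (by fun_prop) (by fun_prop),
      reweight_map (by fun_prop) (by fun_prop) (by fun_prop)]
  · rw [← hEα, ← hK.energy_map_swap β, ← hEβ, ← hK.energy_map_swap β', ← hleft, ← hright]
    exact hK.energy_map_rpow_triangle hq htri Γ (by fun_prop) measurable_fst (by fun_prop)

theorem IsConeKernel.divergence_rpow_triangle (hK : IsConeKernel K) {q : ℝ} (hq : 1 ≤ q)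
    (htri : ∀ t u v a b e : ℝ≥0,
      K t v a e ^ (1 / q) ≤ K t u a b ^ (1 / q) + K u v b e ^ (1 / q))
    (μ : Measure X) (ν : Measure Y) (ρ : Measure Z) [IsFiniteMeasure ν] :
    divergence K μ ρ ^ (1 / q) ≤ divergence K μ ν ^ (1 / q) + divergence K ν ρ ^ (1 / q) := by
  have hq' : 0 < 1 / q := one_div_pos.2 (zero_lt_one.trans_le hq)
  rw [divergence_rpow hq', divergence_rpow hq', divergence_rpow hq']
  refine ENNReal.le_iInf₂_add_iInf₂ fun α hα β hβ => ?_
  obtain ⟨γ, hγ, hle⟩ := hK.exists_comp hq htri hα hβ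
  exact (iInf₂_le γ hγ).trans hle

end Triangle

/-! ### Metrics on quotients -/

theorem exists_metricSpace_quotient {T : Type*} (s : Setoid T) {d : T → T → ℝ}
    (hzero : ∀ x y, d x y = 0 ↔ s x y) (hsymm : ∀ x y, d x y = d y x)
    (htri : ∀ x y z, d x z ≤ d x y + d y z) :
    ∃ m : MetricSpace (Quotient s), ∀ x y, m.dist (Quotient.mk s x) (Quotient.mk s y) = d x y := by
  let _ : PseudoMetricSpace T :=
    { dist := d
      dist_self := fun x => (hzero x x).2 (s.refl x)
      dist_comm := hsymm
      dist_triangle := htri }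
  have hs : s = inseparableSetoid T := Setoid.ext fun x y =>
    (hzero x y).symm.trans (Metric.inseparable_iff (x := x) (y := y)).symm
  rw [hs]
  exact ⟨inferInstanceAs (MetricSpace (SeparationQuotient T)), fun _ _ => rfl⟩

theorem exists_metricSpace_quotient_toReal_rpow {T : Type*} (s : Setoid T) {C : T → T → ℝ≥0∞}
    {r : ℝ} (hr : 0 < r) (hfin : ∀ x y, C x y ≠ ∞) (hzero : ∀ x y, C x y = 0 ↔ s x y)
    (hsymm : ∀ x y, C x y = C y x) (htri : ∀ x y z, C x z ^ r ≤ C x y ^ r + C y z ^ r) :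
    ∃ m : MetricSpace (Quotient s),
      ∀ x y, m.dist (Quotient.mk s x) (Quotient.mk s y) = (C x y).toReal ^ r := by
  have hpow : ∀ x y, C x y ^ r ≠ ∞ := fun x y => ENNReal.rpow_ne_top_of_nonneg hr.le (hfin x y)
  refine exists_metricSpace_quotient s (fun x y => ?_) (fun x y => by rw [hsymm])
    fun x y z => ?_
  · rw [Real.rpow_eq_zero ENNReal.toReal_nonneg hr.ne', ENNReal.toReal_eq_zero_iff,
      or_iff_left (hfin x y), hzero]
  · simp only [ENNReal.toReal_rpow]
    rw [← ENNReal.toReal_add (hpow x y) (hpow y z)]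
    exact ENNReal.toReal_mono (ENNReal.add_ne_top.2 ⟨hpow x y, hpow y z⟩) (htri x y z)

end ConicGW

end

theorem mainTheorem1_general
    (φ lam : ℝ≥0 → ℝ≥0∞) (Δ : ℝ≥0 → ℝ≥0 → ℝ≥0) (p q : ℝ)
    (hφ : ConicGW.IsEntropy φ)
    (hzero : ∀ t u, lam (Δ t u) = 0 ↔ t = u)
    (hsymm : ∀ t u, lam (Δ t u) = lam (Δ u t))
    (hlsc : LowerSemicontinuous (fun z : ℝ≥0 × ℝ≥0 => lam (Δ z.1 z.2)))
    (hp : 0 < p) (hq : 0 < q) :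
    (∀ X Y : ConicGW.MMSpace.{u}, 0 ≤ ConicGW.CGW φ lam Δ p q X Y) ∧
    (∀ X Y : ConicGW.MMSpace.{u},
      ConicGW.CGW φ lam Δ p q X Y = ConicGW.CGW φ lam Δ p q Y X) ∧
    (∀ X Y : ConicGW.MMSpace.{u},
      ConicGW.CGW φ lam Δ p q X Y = 0 ↔ ConicGW.MMSpace.Isometric X Y) ∧
    (1 ≤ q → ConicGW.IsDistance (ConicGW.coneDist φ lam Δ p q) →
      (∀ X Y : ConicGW.MMSpace.{u}, ConicGW.CGW φ lam Δ p q X Y ≠ ∞) ∧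
      ∃ m : MetricSpace (Quotient ConicGW.MMSpace.isometricSetoid.{u}),
        ∀ X Y : ConicGW.MMSpace.{u},
          m.dist (Quotient.mk _ X) (Quotient.mk _ Y) =
            (ConicGW.CGW φ lam Δ p q X Y).toReal ^ (1 / q)) := by
  have hrefl : ∀ t, lam (Δ t t) = 0 := fun t => (hzero t t).2 rfl
  have hK := ConicGW.isConeKernel_coneKernel hφ hzero hsymm hlsc
  have hroot := ConicGW.coneKernel_rpow_eq_coneDist (φ := φ) hrefl hp hq
  have hcomm := fun X Y : ConicGW.MMSpace.{u} => hK.divergence_comm X.meas Y.meas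
  have hiso := fun X Y : ConicGW.MMSpace.{u} =>
    hK.divergence_eq_zero_iff (μ := X.meas) (ν := Y.meas)
  simp only [ConicGW.CGW_eq_divergence hK
    (ConicGW.coneDist_mk_rpow_eq_coneKernel (φ := φ) hrefl hp hq) hp]
  refine ⟨fun _ _ => zero_le, hcomm, hiso, fun hq1 hdist => ?_⟩
  have hKfin : ∀ t u a b, ConicGW.coneKernel φ (fun t u => lam (Δ t u)) t u a b ≠ ∞ :=
    fun t u a b => (ENNReal.rpow_eq_top_iff_of_pos (one_div_pos.2 hq)).not.1 <| by
      rw [hroot]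
      exact hdist.ne_top _ _
  have hfin := fun X Y : ConicGW.MMSpace.{u} =>
    hK.divergence_ne_top (hKfin 0 0 1 0) (hKfin 0 0 0 1) X.meas Y.meas
  refine ⟨hfin, ConicGW.exists_metricSpace_quotient_toReal_rpow _ (one_div_pos.2 hq) hfin hiso
    hcomm fun X Y Z => hK.divergence_rpow_triangle hq1 (fun t u v a b e => ?_) _ _ _⟩
  simp only [hroot]
  exact hdist.triangle _ _ _

theorem mainTheorem1
    (φ lam : ℝ≥0 → ℝ≥0∞) (Δ : ℝ≥0 → ℝ≥0 → ℝ≥0) (p q : ℝ)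
    (hφ : ConicGW.IsEntropy φ)
    (hlam : ∀ t, lam t = 0 ↔ t = 0)
    (hΔ : ConicGW.IsDistance (fun t u => (Δ t u : ℝ≥0∞)))
    (hlsc : LowerSemicontinuous (fun z : ℝ≥0 × ℝ≥0 => lam (Δ z.1 z.2)))
    (hp : 0 < p) (hq : 0 < q) :
    (∀ X Y : ConicGW.MMSpace.{u}, 0 ≤ ConicGW.CGW φ lam Δ p q X Y) ∧
    (∀ X Y : ConicGW.MMSpace.{u},
      ConicGW.CGW φ lam Δ p q X Y = ConicGW.CGW φ lam Δ p q Y X) ∧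
    (∀ X Y : ConicGW.MMSpace.{u},
      ConicGW.CGW φ lam Δ p q X Y = 0 ↔ ConicGW.MMSpace.Isometric X Y) ∧
    (1 ≤ q → ConicGW.IsDistance (ConicGW.coneDist φ lam Δ p q) →
      (∀ X Y : ConicGW.MMSpace.{u}, ConicGW.CGW φ lam Δ p q X Y ≠ ∞) ∧
      ∃ m : MetricSpace (Quotient ConicGW.MMSpace.isometricSetoid.{u}),
        ∀ X Y : ConicGW.MMSpace.{u},
          m.dist (Quotient.mk _ X) (Quotient.mk _ Y) =
            (ConicGW.CGW φ lam Δ p q X Y).toReal ^ (1 / q)) :=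
  mainTheorem1_general φ lam Δ p q hφ
    (fun t u => (hlam _).trans (ENNReal.coe_eq_zero.symm.trans (hΔ.eq_zero_iff t u)))
    (fun t u => congrArg lam (ENNReal.coe_injective (hΔ.symm t u))) hlsc hp hq
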